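/- Let $\mathbb R^3_1$ be $\mathbb R^3$ with the pseudo-scalar product $\langle a,b\rangle=a_0b_0+a_1b_1-a_2b_2$, and define $a\times b$ by $\langle a\times b,c\rangle=\det(a,b,c)$ for all $c$. For a smooth local parametrization $x(u,v)$ of a surface put $E=\langle x_u,x_u\rangle$, $F=\langle x_u,x_v\rangle$, $G=\langle x_v,x_v\rangle$, $\bar l=\langle x_u\times x_v,x_{uu}\rangle$, $\bar m=\langle x_u\times x_v,x_{uv}\rangle$, $\bar n=\langle x_u\times x_v,x_{vv}\rangle$ and $\bar H=\bar lG-2\bar mF+\bar nE$. The mean curvature null curve (MCNC) is the zero set of $\bar H$; the Lorentzian region is $\{F^2-EG>0\}$. Give germs of smooth maps at the origin the Whitney topology, i.e. the coarsest topology for which all the jet maps $f\mapsto j^kf(0)$ are continuous. Let $\mathcal G$ be the set of germs $(M,p)$ of smooth surfaces in $\mathbb R^3_1$, identified with the quotient of the space of germs of local parametrizations $(\mathbb R^2,0)\to(\mathbb R^3_1,p)$ ($p$ arbitrary, differential at $0$ injective) by right-equivalence (composition with germs of diffeomorphisms of $(\mathbb R^2,0)$), with the quotient topology. Let $\mathcal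 G_4\subset\mathcal G$ be the set of $(M,p)$ such that $p=x(0)$ lies in the Lorentzian region and is a singular point of the MCNC, i.e. $\bar H(0)=0$ and $d\bar H(0)=0$. A property is generic in a subset of a topological space if the points of the subset which have it form an open and dense subset for the induced topology. Then the following property of $(M,p)$ is generic in $\mathcal G_4$: for every local parametrization $x$ of $M$ at $p=x(0)$, with associated germ $\bar H$, (1) the MCNC has an $A_1$-singularity at $p$, i.e. $\bar H$ is right-equivalent to $\pm(u^2\pm v^2)$; (2) in a generic 1-parameter family of surfaces deforming $(M,p)$ this singularity is $\mathcal R$-versally deformed. That is, the property that $(u,v,t)\mapsto\bar H_t(u,v)$ is an $\mathcal R$-versal deformation of $\bar H$, where $\bar H_t$ is computed from $x_t$, is generic in the space of all smooth germs of families $x_t(u,v)$ at $(0,0,0)$ with $x_0=x$; and, for each fixed vector $w$ not tangent to $M$ at $p$, it is also generic in the space of germs of smooth functions $h(u,v,t)$ with $h(u,v,0)=0$, for the families $x_t=x+h(\cdot,t)\,w$ (for $x$ in Monge form in the direction $w$ these are the families of graphs of $f+h(\cdot,t)$). Here a deformation $\Phi(q,t)$ of a germ $f=\Phi(\cdot,0)$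 of a function at $0\in\mathbb R^2$ is $\mathcal R$-versal if every smooth deformation $\Gamma(q,s)$ of $f$, $s\in(\mathbb R^k,0)$, $k\ge 0$, can be written $\Gamma(q,s)=\Phi(\varphi(q,s),\psi(s))$ near the origin with smooth germs $\varphi,\psi$ such that $\varphi(q,0)=q$ and $\psi(0)=0$. -/

import Mathlib

open Filter Topology
open scoped ContDiff

noncomputable section

namespace Minkowski

/-! ### Smooth germs, jets, and right-equivalence -/

/-- The parameter plane. -/
abbrev Plane : Type := ℝ × ℝ

/-- `f` is of class `C^∞` on a neighbourhood of the origin. -/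
def SmoothNear {E F : Type*} [NormedAddCommGroup E] [NormedSpace ℝ E]
    [NormedAddCommGroup F] [NormedSpace ℝ F] (f : E → F) : Prop :=
  ∀ᶠ p in 𝓝 (0 : E), ContDiffAt ℝ ∞ f p

/-- Smooth germs `(E, 0) → F`, each given by a representative that is defined everywhere and smooth
near the origin. Everything below depends only on the values of the representative near `0`. -/
structure SmoothGerm (E F : Type*) [NormedAddCommGroup E] [NormedSpace ℝ E]
    [NormedAddCommGroup F] [NormedSpace ℝ F] where
  toFun : E → F
  smooth : SmoothNear toFun

/-- The Whitney topology on germs: the coarsest topology for which all the jet maps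
`f ↦ j^k f(0)` are continuous. (It is also the quotient, under passage to germs, of the Whitney
`C^∞` topology on everywhere defined smooth maps.) -/
instance SmoothGerm.instTopologicalSpace (E F : Type*) [NormedAddCommGroup E] [NormedSpace ℝ E]
    [NormedAddCommGroup F] [NormedSpace ℝ F] : TopologicalSpace (SmoothGerm E F) :=
  ⨅ k : ℕ, TopologicalSpace.induced
    (fun f : SmoothGerm E F => iteratedFDeriv ℝ k f.toFun 0) inferInstance

/-- `φ` represents the germ of a diffeomorphism `(ℝ², 0) → (ℝ², 0)`: it is smooth near `0`, fixes
`0`, and has an inverse germ with the same properties. -/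
def IsDiffeoGerm (φ : Plane → Plane) : Prop :=
  SmoothNear φ ∧ φ 0 = 0 ∧ ∃ ψ : Plane → Plane, SmoothNear ψ ∧ ψ 0 = 0 ∧
    (∀ᶠ q in 𝓝 (0 : Plane), ψ (φ q) = q) ∧ (∀ᶠ q in 𝓝 (0 : Plane), φ (ψ q) = q)

/-- Right-equivalence of germs at the origin of the plane. -/
def REquiv {F : Type*} (f g : Plane → F) : Prop :=
  ∃ φ : Plane → Plane, IsDiffeoGerm φ ∧ ∀ᶠ q in 𝓝 (0 : Plane), g q = f (φ q)

theorem SmoothNear.tendsto {E F : Type*} [NormedAddCommGroup E] [NormedSpace ℝ E]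
    [NormedAddCommGroup F] [NormedSpace ℝ F] {f : E → F} (hf : SmoothNear f) (h0 : f 0 = 0) :
    Tendsto f (𝓝 0) (𝓝 0) := by
  have h : ContinuousAt f 0 := (Eventually.self_of_nhds hf).continuousAt
  simpa [ContinuousAt, h0] using h

theorem SmoothNear.comp {E F G : Type*} [NormedAddCommGroup E] [NormedSpace ℝ E]
    [NormedAddCommGroup F] [NormedSpace ℝ F] [NormedAddCommGroup G] [NormedSpace ℝ G]
    {g : F → G} {f : E → F} (hg : SmoothNear g) (hf : SmoothNear f) (h0 : f 0 = 0) :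
    SmoothNear (fun q => g (f q)) := by
  filter_upwards [hf, (hf.tendsto h0).eventually hg] with q h1 h2
  exact ContDiffAt.comp q h2 h1

theorem REquiv.refl {F : Type*} (f : Plane → F) : REquiv f f := by
  have hid : SmoothNear (fun q : Plane => q) := Eventually.of_forall fun q => contDiffAt_id
  exact ⟨fun q => q, ⟨hid, rfl, fun q => q, hid, rfl, Eventually.of_forall fun _ => rfl,
    Eventually.of_forall fun _ => rfl⟩, Eventually.of_forall fun _ => rfl⟩

theorem REquiv.symm {F : Type*} {f g : Plane → F} (h : REquiv f g) : REquiv g f := by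
  obtain ⟨φ, ⟨h1, h2, ψ, h3, h4, h5, h6⟩, h7⟩ := h
  refine ⟨ψ, ⟨h3, h4, φ, h1, h2, h6, h5⟩, ?_⟩
  filter_upwards [h6, (h3.tendsto h4).eventually h7] with q hq hq'
  rw [hq', hq]

theorem REquiv.trans {F : Type*} {f g k : Plane → F} (h : REquiv f g) (h' : REquiv g k) :
    REquiv f k := by
  obtain ⟨φ, ⟨h1, h2, ψ, h3, h4, h5, h6⟩, h7⟩ := h
  obtain ⟨α, ⟨a1, a2, β, a3, a4, a5, a6⟩, a7⟩ := h'
  refine ⟨fun q => φ (α q), ⟨h1.comp a1 a2, by simp [h2, a2], fun q => β (ψ q), a3.comp h3 h4,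
    by simp [h4, a4], ?_, ?_⟩, ?_⟩
  · filter_upwards [(a1.tendsto a2).eventually h5, a5] with q hq hq'
    rw [hq, hq']
  · filter_upwards [(h3.tendsto h4).eventually a6, h6] with q hq hq'
    rw [hq, hq']
  · filter_upwards [(a1.tendsto a2).eventually h7, a7] with q hq hq'
    rw [hq', hq]

/-- `f` has an `A₁`-singularity at the origin: it is right-equivalent to `±(u² ± v²)`. -/
def IsA1 (f : Plane → ℝ) : Prop :=
  ∃ s r : ℝ, (s = 1 ∨ s = -1) ∧ (r = 1 ∨ r = -1) ∧
    REquiv (fun q : Plane => s * (q.1 ^ 2 + r * q.2 ^ 2)) f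

/-- `G` is (the germ at `0` of) a smooth deformation of the germ `f`, with parameters in `S`. -/
def IsDeformation {S : Type*} [NormedAddCommGroup S] [NormedSpace ℝ S]
    (f : Plane → ℝ) (G : Plane × S → ℝ) : Prop :=
  SmoothNear G ∧ ∀ᶠ q in 𝓝 (0 : Plane), G (q, 0) = f q

/-- The deformation `F` of the germ `f` is `R`-versal: every deformation `G` of `f`, with any number
of parameters, is right-induced from it, `G (q, s) = F (φ (q, s), ψ s)` with smooth germs `φ`, `ψ`
such that `φ (q, 0) = q` and `ψ 0 = 0`. -/
def IsRVersal {T : Type*} [NormedAddCommGroup T] [NormedSpace ℝ T]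
    (f : Plane → ℝ) (F : Plane × T → ℝ) : Prop :=
  IsDeformation f F ∧
  ∀ (k : ℕ) (G : Plane × (Fin k → ℝ) → ℝ), IsDeformation f G →
    ∃ (φ : Plane × (Fin k → ℝ) → Plane) (ψ : (Fin k → ℝ) → T),
      SmoothNear φ ∧ SmoothNear ψ ∧ ψ 0 = 0 ∧
      (∀ᶠ q in 𝓝 (0 : Plane), φ (q, 0) = q) ∧
      (∀ᶠ z in 𝓝 (0 : Plane × (Fin k → ℝ)), G z = F (φ z, ψ z.2))

/-- A property is generic in a subset `S` of a topological space if the points of `S` that have it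
form an open and dense subset of `S`, for the induced topology. -/
def GenericIn {X : Type*} [TopologicalSpace X] (S : Set X) (P : X → Prop) : Prop :=
  IsOpen {g : S | P g} ∧ Dense {g : S | P g}

/-! ### Minkowski 3-space and the fundamental forms of a parametrized surface -/

/-- The underlying vector space of Minkowski 3-space. -/
abbrev Space : Type := Fin 3 → ℝ

/-- The pseudo-scalar product of Minkowski 3-space. -/
def mink (a b : Space) : ℝ := a 0 * b 0 + a 1 * b 1 - a 2 * b 2

/-- The vector product of Minkowski 3-space. -/
def mcross (a b : Space) : Space :=
  ![a 1 * b 2 - a 2 * b 1, a 2 * b 0 - a 0 * b 2, a 1 * b 0 - a 0 * b 1]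

/-- The characteristic property of the vector product. -/
theorem mink_mcross (a b c : Space) : mink (mcross a b) c = (Matrix.of ![a, b, c]).det := by
  simp [mink, mcross, Matrix.det_fin_three]
  ring

/-- Partial derivative in the first variable. -/
def du (x : Plane → Space) (q : Plane) : Space := fderiv ℝ x q (1, 0)

/-- Partial derivative in the second variable. -/
def dv (x : Plane → Space) (q : Plane) : Space := fderiv ℝ x q (0, 1)

/-- First fundamental form, coefficient `E`. -/
def coeffE (x : Plane → Space) (q : Plane) : ℝ := mink (du x q) (du x q)

/-- First fundamental form, coefficient `F`. -/
def coeffF (x : Plane → Space) (q : Plane) : ℝ := mink (du x q) (dv x q)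

/-- First fundamental form, coefficient `G`. -/
def coeffG (x : Plane → Space) (q : Plane) : ℝ := mink (dv x q) (dv x q)

/-- `δ = F² - E G`, positive exactly where the induced metric is Lorentzian. -/
def delta (x : Plane → Space) (q : Plane) : ℝ := coeffF x q ^ 2 - coeffE x q * coeffG x q

/-- The coefficient `⟨x_u × x_v, x_uu⟩`. -/
def lbar (x : Plane → Space) (q : Plane) : ℝ := mink (mcross (du x q) (dv x q)) (du (du x) q)

/-- The coefficient `⟨x_u × x_v, x_uv⟩`. -/
def mbar (x : Plane → Space) (q : Plane) : ℝ := mink (mcross (du x q) (dv x q)) (dv (du x) q)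

/-- The coefficient `⟨x_u × x_v, x_vv⟩`. -/
def nbar (x : Plane → Space) (q : Plane) : ℝ := mink (mcross (du x q) (dv x q)) (dv (dv x) q)

/-- The function whose zero set is the mean curvature null curve (MCNC). -/
def Hbar (x : Plane → Space) (q : Plane) : ℝ :=
  lbar x q * coeffG x q - 2 * mbar x q * coeffF x q + nbar x q * coeffE x q

/-! ### Germs of surfaces -/

/-- Germs at the origin of local parametrizations `(ℝ², 0) → (ℝ³₁, p)`, with `p` arbitrary. As the
differential at `0` is injective, the map is a homeomorphism onto its image near `0`. -/
structure LocalParam extends SmoothGerm Plane Space where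
  immersion : Function.Injective (fderiv ℝ toFun 0)

instance LocalParam.instTopologicalSpace : TopologicalSpace LocalParam :=
  TopologicalSpace.induced LocalParam.toSmoothGerm inferInstance

/-- Two local parametrizations give the same germ of surface when they are right-equivalent. (In
particular, representatives of the same germ of map are identified.) -/
instance LocalParam.instSetoid : Setoid LocalParam where
  r x y := REquiv x.toFun y.toFun
  iseqv := ⟨fun x => REquiv.refl x.toFun, fun h => REquiv.symm h, fun h h' => REquiv.trans h h'⟩

/-- Germs `(M, p)` of smooth surfaces in Minkowski 3-space, as germs of local parametrizations modulo
right-equivalence. -/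
def SurfaceGerm : Type := Quotient LocalParam.instSetoid

/-- The germ of surface with local parametrization `x`. -/
def LocalParam.surface (x : LocalParam) : SurfaceGerm := Quotient.mk LocalParam.instSetoid x

/-- Germs of surfaces carry the quotient topology. -/
instance SurfaceGerm.instTopologicalSpace : TopologicalSpace SurfaceGerm :=
  inferInstanceAs (TopologicalSpace (Quotient LocalParam.instSetoid))

/-- The germs `(M, p)` such that `p` lies in the Lorentzian region of `M` and is a singular point of
the MCNC. -/
def singularMCNC : Set SurfaceGerm :=
  {g | ∃ x : LocalParam, x.surface = g ∧ 0 < delta x.toFun 0 ∧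
    Hbar x.toFun 0 = 0 ∧ fderiv ℝ (Hbar x.toFun) 0 = 0}

/-! ### One-parameter families of surfaces -/

/-- The functions `H̄_t` of a 1-parameter family of parametrizations `X (·, t)`, as one function
of `(q, t)`. Its zero set at time `t` is the MCNC of the surface at time `t`. -/
def HbarFamily (X : Plane × ℝ → Space) : Plane × ℝ → ℝ :=
  fun z => Hbar (fun q => X (q, z.2)) z.1

/-- The germs of smooth 1-parameter families of parametrized surfaces deforming `x`. -/
def familiesOf (x : LocalParam) : Set (SmoothGerm (Plane × ℝ) Space) :=
  {X | ∀ᶠ q in 𝓝 (0 : Plane), X.toFun (q, 0) = x.toFun q}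

/-- The germs of smooth functions `h (q, t)` with `h (q, 0) = 0`, which define 1-parameter families
of surfaces `x + h w` when `w` is a vector transverse to the surface. -/
def heightPerturbations : Set (SmoothGerm (Plane × ℝ) ℝ) :=
  {h | ∀ᶠ q in 𝓝 (0 : Plane), h.toFun (q, 0) = 0}

/-- In a generic 1-parameter family of surfaces deforming the surface parametrized by `x`, the MCNC
is `R`-versally deformed. Generic families are understood in both usual senses: among all families
of parametrizations which start at `x`, and, for every vector `w` transverse to the surface at its
base point, among all the families `x + h w` with `h (q, 0) = 0`. If `x` is a Monge form, a graph
in the direction of `w`, the latter are the families of graphs `f + h`. -/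
def GenericallyVersal (x : LocalParam) : Prop :=
  GenericIn (familiesOf x) (fun X => IsRVersal (Hbar x.toFun) (HbarFamily X.toFun)) ∧
  ∀ w : Space, w ∉ Set.range (fderiv ℝ x.toFun 0) →
    GenericIn heightPerturbations (fun h =>
      IsRVersal (Hbar x.toFun) (HbarFamily fun z => x.toFun z.1 + h.toFun z • w))

end Minkowski

end

/-! Everything reduces to the Hessian determinant of `Hbar` at the base point. Under a change of
parameters `Hbar` is multiplied by the cube of the Jacobian (`Hbar_comp`). So at a singular point of
the MCNC, vanishing of `hessDet` does not depend on the parametrization: it is multiplied by the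
eighth power of the Jacobian at the origin (`REquiv.Hbar_singular`).

By the Morse lemma a critical point on the zero set is of type A1 exactly when its Hessian is
nondegenerate. The Morse lemma with parameters (`exists_morse_normal_form`) moreover writes every
deformation as a critical value, depending on the parameters alone, plus a constant quadratic form
in new coordinates. Hence a 1-parameter deformation of an A1 point is versal if and only if its
velocity at the point is nonzero (`isRVersal_iff_of_hessDet_ne_zero`).

Both nondegeneracy conditions are open, since they involve finitely many derivatives at the origin,
which are continuous in the germ (`ContFam`). For surfaces the open set of parametrizations is
saturated, so it descends to the quotient (`isOpen_nondegenerate`).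

Density comes from displacements `g w` in a transverse direction `w`. With T = ⟨x_u × x_v, w⟩ ≠ 0,
they change `Hbar` by T (G g_uu - 2 F g_uv + E g_vv), up to terms divisible by the first derivatives
of g (`exists_HbarAlong_add_smul`). For g = t u²v²/2 the 1-jet of `Hbar` is unchanged and the
Hessian determinant becomes a quadratic polynomial in t with leading coefficient 4T²(EG - 4F²). For
a family, g = ε t (G u² - F uv + E v²), with coefficients taken at the origin, changes the velocity
by 2T(E² + F² + G²) ε. The Lorentzian condition F² > EG makes both numbers nonzero, so arbitrarily
small parameters repair a degenerate germ or a nonversal family. -/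

namespace Minkowski

/-! ### Calculus of smooth germs: inverse functions, integrals with parameters, Hadamard's lemma -/

section GermCalculus

variable {E F G : Type*} [NormedAddCommGroup E] [NormedSpace ℝ E]
  [NormedAddCommGroup F] [NormedSpace ℝ F] [NormedAddCommGroup G] [NormedSpace ℝ G]

/-- The derivative of `f` at `z` in the direction `e`. -/
noncomputable def pd (e : E) (f : E → F) (z : E) : F := fderiv ℝ f z e

theorem pd_eq_of_eventuallyEq {f g : E → F} {z : E} (e : E) (h : f =ᶠ[𝓝 z] g) :
    pd e f z = pd e g z := by
  simp only [pd, h.fderiv_eq]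

theorem pd_eventuallyEq {f g : E → F} {z : E} (e : E) (h : f =ᶠ[𝓝 z] g) :
    pd e f =ᶠ[𝓝 z] pd e g := by
  filter_upwards [h.fderiv (𝕜 := ℝ)] with w hw
  simp only [pd, hw]

theorem SmoothNear.self {f : E → F} (hf : SmoothNear f) : ContDiffAt ℝ ∞ f 0 :=
  Eventually.self_of_nhds hf

theorem SmoothNear.differentiableAt {f : E → F} (hf : SmoothNear f) : DifferentiableAt ℝ f 0 :=
  hf.self.differentiableAt (by simp)

theorem SmoothNear.eventually_differentiableAt {f : E → F} (hf : SmoothNear f) :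
    ∀ᶠ z in 𝓝 0, DifferentiableAt ℝ f z := by
  filter_upwards [hf] with z hz using hz.differentiableAt (by simp)

theorem SmoothNear.congr {f g : E → F} (hf : SmoothNear f) (h : f =ᶠ[𝓝 0] g) : SmoothNear g := by
  filter_upwards [hf, h.eventuallyEq_nhds] with z hz hz' using hz.congr_of_eventuallyEq hz'.symm

theorem _root_.ContDiff.smoothNear {f : E → F} (hf : ContDiff ℝ ∞ f) : SmoothNear f :=
  Eventually.of_forall fun _ => hf.contDiffAt

theorem smoothNear_const (c : F) : SmoothNear (fun _ : E => c) := contDiff_const.smoothNear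

theorem SmoothNear.add {f g : E → F} (hf : SmoothNear f) (hg : SmoothNear g) :
    SmoothNear (fun z => f z + g z) := by
  filter_upwards [hf, hg] with z h1 h2 using h1.add h2

theorem SmoothNear.sub {f g : E → F} (hf : SmoothNear f) (hg : SmoothNear g) :
    SmoothNear (fun z => f z - g z) := by
  filter_upwards [hf, hg] with z h1 h2 using h1.sub h2

theorem SmoothNear.mul {f g : E → ℝ} (hf : SmoothNear f) (hg : SmoothNear g) :
    SmoothNear (fun z => f z * g z) := by
  filter_upwards [hf, hg] with z h1 h2 using h1.mul h2

theorem SmoothNear.pow {f : E → ℝ} (hf : SmoothNear f) (n : ℕ) :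
    SmoothNear (fun z => f z ^ n) := by
  filter_upwards [hf] with z h1 using h1.pow n

theorem SmoothNear.smul {f : E → ℝ} {g : E → F} (hf : SmoothNear f) (hg : SmoothNear g) :
    SmoothNear (fun z => f z • g z) := by
  filter_upwards [hf, hg] with z h1 h2 using h1.smul h2

theorem SmoothNear.prodMk {f : E → F} {g : E → G} (hf : SmoothNear f) (hg : SmoothNear g) :
    SmoothNear (fun z => (f z, g z)) := by
  filter_upwards [hf, hg] with z h1 h2 using h1.prodMk h2

theorem SmoothNear.fst {f : E → F × G} (hf : SmoothNear f) : SmoothNear (fun z => (f z).1) := by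
  filter_upwards [hf] with z h using h.fst

theorem SmoothNear.snd {f : E → F × G} (hf : SmoothNear f) : SmoothNear (fun z => (f z).2) := by
  filter_upwards [hf] with z h using h.snd

theorem SmoothNear.dirDeriv {f : E → F} (hf : SmoothNear f) (e : E) : SmoothNear (pd e f) := by
  filter_upwards [hf] with z hz
  exact (hz.fderiv_right (m := ∞) (by simp)).clm_apply contDiffAt_const

theorem SmoothNear.sqrt {f : E → ℝ} (hf : SmoothNear f) (h0 : f 0 ≠ 0) :
    SmoothNear (fun z => √(f z)) := by
  have hc : ContinuousAt f 0 := hf.self.continuousAt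
  filter_upwards [hf, hc.eventually_ne h0] with z h1 h2 using h1.sqrt h2

theorem SmoothNear.inv {f : E → ℝ} (hf : SmoothNear f) (h0 : f 0 ≠ 0) :
    SmoothNear (fun z => (f z)⁻¹) := by
  have hc : ContinuousAt f 0 := hf.self.continuousAt
  filter_upwards [hf, hc.eventually_ne h0] with z h1 h2 using h1.inv h2

theorem pd_add {f g : E → F} {z : E} (e : E) (hf : DifferentiableAt ℝ f z)
    (hg : DifferentiableAt ℝ g z) : pd e (fun z => f z + g z) z = pd e f z + pd e g z := by
  simp only [pd, fderiv_fun_add hf hg, add_apply]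

theorem pd_mul {f g : E → ℝ} {z : E} (e : E) (hf : DifferentiableAt ℝ f z)
    (hg : DifferentiableAt ℝ g z) :
    pd e (fun z => f z * g z) z = pd e f z * g z + f z * pd e g z := by
  simp only [pd, fderiv_fun_mul hf hg, add_apply,
    smul_apply, smul_eq_mul]
  ring

theorem pd_const (e : E) (c : F) (z : E) : pd e (fun _ => c) z = 0 := by
  simp [pd]

/-- Second derivatives of smooth germs commute. -/
theorem pd_pd_comm {f : E → F} {z : E} (hf : ContDiffAt ℝ ∞ f z) (e e' : E) :
    pd e (pd e' f) z = pd e' (pd e f) z := by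
  have hd : DifferentiableAt ℝ (fderiv ℝ f) z :=
    (hf.fderiv_right (m := ∞) (by simp)).differentiableAt (by simp)
  have key : ∀ a b : E, pd a (pd b f) z = fderiv ℝ (fderiv ℝ f) z a b := by
    intro a b
    have : pd b f = fun w => fderiv ℝ f w b := rfl
    simp only [this]
    rw [pd, fderiv_clm_apply hd (differentiableAt_const b)]
    simp
  have hs : IsSymmSndFDerivAt ℝ f z := hf.isSymmSndFDerivAt
    (by simpa using (WithTop.coe_le_coe.2 le_top : ((2 : ℕ∞) : WithTop ℕ∞) ≤ ((⊤ : ℕ∞) : WithTop ℕ∞)))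
  rw [key, key, hs.eq]

/-- A smooth germ has a representative that is smooth everywhere. -/
theorem SmoothNear.exists_contDiff [FiniteDimensional ℝ E] {f : E → F} (hf : SmoothNear f) :
    ∃ g : E → F, ContDiff ℝ ∞ g ∧ f =ᶠ[𝓝 0] g := by
  obtain ⟨ε, hε, hball⟩ := Metric.eventually_nhds_iff_ball.1 hf
  let χ : ContDiffBump (0 : E) := ⟨ε / 3, ε / 2, by positivity, by linarith⟩
  refine ⟨fun z => χ z • f z, contDiff_iff_contDiffAt.2 fun z => ?_, ?_⟩
  · by_cases hz : z ∈ Metric.ball (0 : E) ε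
    · exact χ.contDiffAt.smul (hball z hz)
    · have hz' : z ∉ tsupport χ := by
        rw [χ.tsupport_eq]
        simp only [Metric.mem_ball, Metric.mem_closedBall, not_lt, not_le] at hz ⊢
        exact lt_of_lt_of_le (half_lt_self hε) hz
      have h0 : (fun z => χ z • f z) =ᶠ[𝓝 z] fun _ => 0 := by
        filter_upwards [(notMem_tsupport_iff_eventuallyEq.1 hz')] with w hw
        simp [hw]
      exact contDiffAt_const.congr_of_eventuallyEq h0
  · filter_upwards [χ.eventuallyEq_one] with z hz
    simp [hz]

/-- The inverse function theorem for smooth germs. -/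
theorem SmoothNear.exists_inverse [FiniteDimensional ℝ E] {f : E → E} (hf : SmoothNear f)
    (h0 : f 0 = 0) (hinj : ∀ v, fderiv ℝ f 0 v = 0 → v = 0) :
    ∃ g : E → E, SmoothNear g ∧ g 0 = 0 ∧ (∀ᶠ z in 𝓝 0, g (f z) = z) ∧
      ∀ᶠ z in 𝓝 0, f (g z) = z := by
  have : CompleteSpace E := FiniteDimensional.complete ℝ E
  let A : E ≃L[ℝ] E := (LinearEquiv.ofInjectiveEndo (fderiv ℝ f 0 : E →ₗ[ℝ] E)
    ((injective_iff_map_eq_zero _).2 hinj)).toContinuousLinearEquiv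
  have hA : (A : E →L[ℝ] E) = fderiv ℝ f 0 := by
    ext v; rfl
  have hd : HasFDerivAt f (A : E →L[ℝ] E) 0 := hA ▸ hf.differentiableAt.hasFDerivAt
  let P := hf.self.toOpenPartialHomeomorph f hd (by simp)
  have hP : ∀ z, P z = f z := fun _ => rfl
  have hsrc : (0 : E) ∈ P.source := hf.self.mem_toOpenPartialHomeomorph_source hd (by simp)
  have htgt : (0 : E) ∈ P.target := by simpa [h0, hP] using P.map_source hsrc
  have hs0 : P.symm 0 = 0 := by
    have := P.left_inv hsrc
    rwa [hP, h0] at this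
  have hcont : ContinuousAt P.symm 0 := P.continuousAt_symm htgt
  have hfc : ContinuousAt (fderiv ℝ f) 0 :=
    (hf.self.fderiv_right (m := ∞) (by simp)).continuousAt
  -- Smoothness of the inverse is needed on a whole neighbourhood, hence invertibility of the
  -- derivative at nearby points; the isomorphisms form an open set.
  have hequiv : ∀ᶠ z in 𝓝 (0 : E), fderiv ℝ f z ∈ Set.range ((↑) : (E ≃L[ℝ] E) → E →L[ℝ] E) :=
    hfc.eventually (hA ▸ ContinuousLinearEquiv.nhds A)
  refine ⟨P.symm, ?_, hs0, ?_, ?_⟩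
  · have ht : Tendsto P.symm (𝓝 0) (𝓝 0) := by simpa [ContinuousAt, hs0] using hcont
    filter_upwards [P.open_target.mem_nhds htgt, ht.eventually hequiv, ht.eventually hf]
      with w hw1 ⟨B, hB⟩ hw3
    refine P.contDiffAt_symm (f₀' := B) hw1 ?_ hw3
    rw [hB]
    exact (hw3.differentiableAt (by simp)).hasFDerivAt
  · filter_upwards [P.open_source.mem_nhds hsrc] with z hz using P.left_inv hz
  · filter_upwards [P.open_target.mem_nhds htgt] with z hz using P.right_inv hz

/-- Integration over a compact interval preserves smoothness in the parameter. -/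
theorem contDiff_integral_zero_one {f : E × ℝ → ℝ} (hf : ContDiff ℝ ∞ f) :
    ContDiff ℝ ∞ (fun x => ∫ r in (0 : ℝ)..1, f (x, r)) := by
  -- The integral is the value at 0 of the convolution of the indicator of (0, 1] with y ↦ f (x,
  -- -y). The cutoff `χ` makes the second factor compactly supported and equals 1 at the points -r
  -- with r in (0, 1].
  let χ : ContDiffBump (0 : ℝ) := ⟨2, 3, by norm_num, by norm_num⟩
  let g : E → ℝ → ℝ := fun x y => χ y * f (x, -y)
  have hg : ContDiff ℝ ∞ (Function.uncurry g) := by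
    apply (χ.contDiff.comp contDiff_snd).mul (hf.comp (contDiff_fst.prodMk contDiff_snd.neg))
  have hloc : MeasureTheory.LocallyIntegrable
      ((Set.Ioc (0 : ℝ) 1).indicator fun _ => (1 : ℝ)) MeasureTheory.volume :=
    (MeasureTheory.locallyIntegrable_const (1 : ℝ)).indicator measurableSet_Ioc
  have h := MeasureTheory.contDiffOn_convolution_right_with_param_comp (n := ⊤) (μ := MeasureTheory.volume)
    (ContinuousLinearMap.mul ℝ ℝ) (s := Set.univ) (v := fun _ : E => (0 : ℝ))
    (f := (Set.Ioc (0 : ℝ) 1).indicator fun _ => (1 : ℝ)) (g := g)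
    (k := Metric.closedBall (0 : ℝ) 3) contDiffOn_const isOpen_univ (isCompact_closedBall _ _)
    (fun x y _ hy => by
      have : χ y = 0 := by
        by_contra hne
        have : y ∈ Function.support χ := hne
        rw [χ.support_eq] at this
        exact hy (Metric.ball_subset_closedBall this)
      simp [g, this]) hloc hg.contDiffOn
  rw [contDiffOn_univ] at h
  convert h using 2 with x
  rw [MeasureTheory.convolution, intervalIntegral.integral_of_le zero_le_one,
    ← MeasureTheory.integral_indicator measurableSet_Ioc]
  congr 1
  ext r
  by_cases hr : r ∈ Set.Ioc (0 : ℝ) 1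
  · have : χ (0 - r) = 1 := by
      apply χ.one_of_mem_closedBall
      simp only [Metric.mem_closedBall, dist_zero_right, Real.norm_eq_abs, zero_sub, abs_neg]
      change |r| ≤ 2
      rw [abs_le]
      constructor <;> linarith [hr.1, hr.2]
    simp only [Set.indicator_of_mem hr, g, this, ContinuousLinearMap.mul_apply', one_mul]
    simp
  · simp [Set.indicator_of_notMem hr]

variable {S : Type*} [NormedAddCommGroup S] [NormedSpace ℝ S]

/-- Hadamard's lemma, with parameters. -/
theorem SmoothNear.exists_hadamard [FiniteDimensional ℝ S] {f : Plane × S → ℝ} (hf : SmoothNear f)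
    (h0 : ∀ᶠ s in 𝓝 (0 : S), f (0, s) = 0) :
    ∃ a b : Plane × S → ℝ, SmoothNear a ∧ SmoothNear b ∧
      ∀ᶠ z in 𝓝 (0 : Plane × S), f z = z.1.1 * a z + z.1.2 * b z := by
  obtain ⟨g, hg, hfg⟩ := hf.exists_contDiff
  -- The germ is the integral of its derivative along the segment from (0, s) to (q, s); the two
  -- partial derivatives, averaged over the segment, are the coefficients.
  let γ : (Plane × S) × ℝ → Plane × S := fun p => (p.2 • p.1.1, p.1.2)
  have hγ : ContDiff ℝ ∞ γ :=
    (contDiff_snd.smul contDiff_fst.fst).prodMk contDiff_fst.snd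
  have hfd : ContDiff ℝ ∞ (fderiv ℝ g) := hg.fderiv_right (by simp)
  have hsm : ∀ e : Plane × S, ContDiff ℝ ∞ (fun p : (Plane × S) × ℝ => fderiv ℝ g (γ p) e) :=
    fun e => (hfd.comp hγ).clm_apply contDiff_const
  refine ⟨_, _, (contDiff_integral_zero_one (hsm ((1, 0), 0))).smoothNear,
    (contDiff_integral_zero_one (hsm ((0, 1), 0))).smoothNear, ?_⟩
  have hs : Tendsto (fun z : Plane × S => z.2) (𝓝 0) (𝓝 0) := continuous_snd.tendsto' _ _ rfl
  have hs' : Tendsto (fun z : Plane × S => ((0, z.2) : Plane × S)) (𝓝 0) (𝓝 0) :=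
    (continuous_const.prodMk continuous_snd).tendsto' _ _ rfl
  filter_upwards [hfg, hs.eventually h0, hs'.eventually hfg] with z h1 h2 h3
  have hcont : ∀ e : Plane × S, Continuous (fun r : ℝ => fderiv ℝ g (γ (z, r)) e) :=
    fun e => (hsm e).continuous.comp (continuous_const.prodMk continuous_id)
  have hderiv : ∀ r ∈ Set.uIcc (0 : ℝ) 1, HasDerivAt (fun r : ℝ => g (γ (z, r)))
      (z.1.1 * fderiv ℝ g (γ (z, r)) ((1, 0), 0) + z.1.2 * fderiv ℝ g (γ (z, r)) ((0, 1), 0)) r := by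
    intro r _
    have hc : HasDerivAt (fun r : ℝ => γ (z, r)) (z.1, 0) r := by
      have h := ((hasDerivAt_id r).smul_const z.1).prodMk (hasDerivAt_const r z.2)
      simpa [γ] using h
    have hg' : HasFDerivAt g (fderiv ℝ g (γ (z, r))) (γ (z, r)) :=
      (hg.differentiable (by simp) _).hasFDerivAt
    have h := hg'.comp_hasDerivAt r hc
    have hz : ((z.1, 0) : Plane × S) = z.1.1 • ((1, 0), 0) + z.1.2 • ((0, 1), 0) := by
      ext <;> simp
    rw [hz, map_add, map_smul, map_smul] at h
    exact h
  have hi : ∀ (c : ℝ) (e : Plane × S), IntervalIntegrable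
      (fun r : ℝ => c * fderiv ℝ g (γ (z, r)) e) MeasureTheory.volume 0 1 :=
    fun c e => (continuous_const.mul (hcont e)).intervalIntegrable 0 1
  have hint := intervalIntegral.integral_eq_sub_of_hasDerivAt hderiv ((hi _ _).add (hi _ _))
  rw [intervalIntegral.integral_add (hi _ _) (hi _ _),
    intervalIntegral.integral_const_mul, intervalIntegral.integral_const_mul] at hint
  rw [hint, h1]
  have e1 : γ (z, 1) = z := by simp [γ]
  have e0 : γ (z, 0) = (0, z.2) := by simp [γ]
  rw [e1, e0, ← h3, h2, sub_zero]

end GermCalculus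

/-- The determinant of the Hessian matrix at the origin. -/
noncomputable def hessDet (f : Plane → ℝ) : ℝ :=
  pd (1, 0) (pd (1, 0) f) 0 * pd (0, 1) (pd (0, 1) f) 0 - pd (0, 1) (pd (1, 0) f) 0 ^ 2

/-! ### The Morse lemma with parameters -/

section Morse

variable {S : Type*} [NormedAddCommGroup S] [NormedSpace ℝ S]

theorem smoothNear_coord_fst : SmoothNear (fun z : Plane × S => z.1.1) :=
  contDiff_fst.fst.smoothNear

theorem smoothNear_coord_snd : SmoothNear (fun z : Plane × S => z.1.2) :=
  contDiff_fst.snd.smoothNear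

theorem pd_coord_fst (e z : Plane × S) : pd e (fun z : Plane × S => z.1.1) z = e.1.1 := by
  have h : HasFDerivAt (fun z : Plane × S => z.1.1)
    ((ContinuousLinearMap.fst ℝ ℝ ℝ).comp (ContinuousLinearMap.fst ℝ Plane S)) z :=
    ((ContinuousLinearMap.fst ℝ ℝ ℝ).comp (ContinuousLinearMap.fst ℝ Plane S)).hasFDerivAt
  simp [pd, h.fderiv]

theorem pd_coord_snd (e z : Plane × S) : pd e (fun z : Plane × S => z.1.2) z = e.1.2 := by
  have h : HasFDerivAt (fun z : Plane × S => z.1.2)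
    ((ContinuousLinearMap.snd ℝ ℝ ℝ).comp (ContinuousLinearMap.fst ℝ Plane S)) z :=
    ((ContinuousLinearMap.snd ℝ ℝ ℝ).comp (ContinuousLinearMap.fst ℝ Plane S)).hasFDerivAt
  simp [pd, h.fderiv]

theorem pd_coord_combination {f a b : Plane × S → ℝ} (ha : SmoothNear a) (hb : SmoothNear b)
    (hf : ∀ᶠ z in 𝓝 0, f z = z.1.1 * a z + z.1.2 * b z) (e : Plane × S) :
    ∀ᶠ z in 𝓝 0, pd e f z =
      e.1.1 * a z + z.1.1 * pd e a z + (e.1.2 * b z + z.1.2 * pd e b z) := by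
  filter_upwards [EventuallyEq.eventuallyEq_nhds hf, ha.eventually_differentiableAt,
    hb.eventually_differentiableAt, smoothNear_coord_fst.eventually_differentiableAt,
    smoothNear_coord_snd.eventually_differentiableAt] with z hz h1 h2 h3 h4
  rw [pd_eq_of_eventuallyEq e hz, pd_add e (h3.fun_mul h1) (h4.fun_mul h2), pd_mul e h3 h1, pd_mul e h4 h2,
    pd_coord_fst, pd_coord_snd]

/-- At the origin only the terms in which one of the two derivatives falls on a coordinate survive.
This reads off the Hessian from the coefficients given by Hadamard's lemma. -/
theorem pd_pd_coord_combination {f a b : Plane × S → ℝ} (ha : SmoothNear a) (hb : SmoothNear b)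
    (hf : ∀ᶠ z in 𝓝 0, f z = z.1.1 * a z + z.1.2 * b z) (e e' : Plane × S) :
    pd e' (pd e f) 0 = e.1.1 * pd e' a 0 + e'.1.1 * pd e a 0 +
      (e.1.2 * pd e' b 0 + e'.1.2 * pd e b 0) := by
  have h1 := smoothNear_coord_fst (S := S) |>.differentiableAt
  have h2 := smoothNear_coord_snd (S := S) |>.differentiableAt
  have d := fun {g : Plane × S → ℝ} (h : SmoothNear g) => h.differentiableAt
  have hc := fun (c : ℝ) => differentiableAt_const (𝕜 := ℝ) (x := (0 : Plane × S)) c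
  rw [pd_eq_of_eventuallyEq e' (pd_coord_combination ha hb hf e),
    pd_add e' (((hc _).fun_mul (d ha)).fun_add (h1.fun_mul (d (ha.dirDeriv e))))
      (((hc _).fun_mul (d hb)).fun_add (h2.fun_mul (d (hb.dirDeriv e)))),
    pd_add e' ((hc _).fun_mul (d ha)) (h1.fun_mul (d (ha.dirDeriv e))),
    pd_add e' ((hc _).fun_mul (d hb)) (h2.fun_mul (d (hb.dirDeriv e))),
    pd_mul e' (hc _) (d ha), pd_mul e' (hc _) (d hb), pd_mul e' h1 (d (ha.dirDeriv e)),
    pd_mul e' h2 (d (hb.dirDeriv e)), pd_coord_fst, pd_coord_snd, pd_const, pd_const]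
  simp

/-- A smooth germ whose restrictions to the slices vanish to second order along the zero section is
a quadratic form with smooth coefficients. -/
theorem SmoothNear.exists_quadratic [FiniteDimensional ℝ S] {f : Plane × S → ℝ} (hf : SmoothNear f)
    (h0 : ∀ᶠ s in 𝓝 (0 : S), f (0, s) = 0)
    (h1 : ∀ᶠ s in 𝓝 (0 : S), pd ((1, 0), 0) f (0, s) = 0)
    (h2 : ∀ᶠ s in 𝓝 (0 : S), pd ((0, 1), 0) f (0, s) = 0) :
    ∃ a b c : Plane × S → ℝ, SmoothNear a ∧ SmoothNear b ∧ SmoothNear c ∧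
      (∀ᶠ z in 𝓝 (0 : Plane × S),
        f z = a z * z.1.1 ^ 2 + 2 * b z * z.1.1 * z.1.2 + c z * z.1.2 ^ 2) ∧
      pd ((1, 0), 0) (pd ((1, 0), 0) f) 0 = 2 * a 0 ∧
      pd ((0, 1), 0) (pd ((1, 0), 0) f) 0 = 2 * b 0 ∧
      pd ((0, 1), 0) (pd ((0, 1), 0) f) 0 = 2 * c 0 := by
  obtain ⟨A, B, hA, hB, hAB⟩ := hf.exists_hadamard h0
  have hs : Tendsto (fun s : S => ((0, s) : Plane × S)) (𝓝 0) (𝓝 0) :=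
    (continuous_const.prodMk continuous_id).tendsto' _ _ rfl
  have hA0 : ∀ᶠ s in 𝓝 (0 : S), A (0, s) = 0 := by
    filter_upwards [h1, hs.eventually (pd_coord_combination hA hB hAB ((1, 0), 0))] with s e1 e2
    rw [e1] at e2
    simpa using e2.symm
  have hB0 : ∀ᶠ s in 𝓝 (0 : S), B (0, s) = 0 := by
    filter_upwards [h2, hs.eventually (pd_coord_combination hA hB hAB ((0, 1), 0))] with s e1 e2
    rw [e1] at e2
    simpa using e2.symm
  obtain ⟨a, b₁, ha, hb₁, hab⟩ := hA.exists_hadamard hA0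
  obtain ⟨b₂, c, hb₂, hc, hbc⟩ := hB.exists_hadamard hB0
  have pA := fun e => (pd_coord_combination ha hb₁ hab e).self_of_nhds
  have pB := fun e => (pd_coord_combination hb₂ hc hbc e).self_of_nhds
  -- Two applications of Hadamard's lemma give two mixed coefficients, whose mean is the
  -- off-diagonal entry of a symmetric matrix.
  refine ⟨a, fun z => (1 / 2) * (b₁ z + b₂ z), c, ha,
    (smoothNear_const _).mul (hb₁.add hb₂), hc, ?_, ?_, ?_, ?_⟩
  · filter_upwards [hAB, hab, hbc] with z e1 e2 e3
    rw [e1, e2, e3]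
    ring
  all_goals
    rw [pd_pd_coord_combination hA hB hAB]
    simp only [pA, pB]
    simp
    try ring

/-- Write A₀, A for the symmetric matrices and B for the matrix with entries p, q, r, s, so that A₀B
= A and d² = det B. Symmetry of A makes B self-adjoint for A₀, so (B + d)ᵀA₀(B + d) = A₀(B + d)². By
Cayley–Hamilton (B + d)² = (tr B + 2d)B. Thus (B + d)/√(tr B + 2d) is a square root of B that
carries the form A₀ to A. -/
theorem quadratic_form_eq_of_matrix_sqrt {a₀ b₀ c₀ p q r s d a b c : ℝ}
    (ha : a₀ * p + b₀ * r = a) (hb : a₀ * q + b₀ * s = b) (hb' : b₀ * p + c₀ * r = b)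
    (hc : b₀ * q + c₀ * s = c) (hd : d ^ 2 = p * s - q * r) (u v : ℝ) :
    a₀ * ((p + d) * u + q * v) ^ 2 +
      2 * b₀ * ((p + d) * u + q * v) * (r * u + (s + d) * v) +
      c₀ * (r * u + (s + d) * v) ^ 2 =
    (p + s + 2 * d) * (a * u ^ 2 + 2 * b * u * v + c * v ^ 2) := by
  subst ha hc
  subst hb
  grind

/-- A quadratic form with smooth coefficients, nondegenerate at the origin, becomes constant after a
smooth change of coordinates tangent to the identity in the fibre directions. -/
theorem exists_coordinates_quadratic {a b c : Plane × S → ℝ} (ha : SmoothNear a)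
    (hb : SmoothNear b) (hc : SmoothNear c) (hdet : a 0 * c 0 - b 0 ^ 2 ≠ 0) :
    ∃ y : Plane × S → Plane, SmoothNear y ∧ y 0 = 0 ∧ (∀ q, fderiv ℝ y 0 (q, 0) = q) ∧
      ∀ᶠ z in 𝓝 (0 : Plane × S),
        a 0 * (y z).1 ^ 2 + 2 * b 0 * (y z).1 * (y z).2 + c 0 * (y z).2 ^ 2 =
        a z * z.1.1 ^ 2 + 2 * b z * z.1.1 * z.1.2 + c z * z.1.2 ^ 2 := by
  set δ := a 0 * c 0 - b 0 ^ 2 with hδ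
  -- The entries of B = A(0)⁻¹ A(z), which is the identity at the origin.
  let p : Plane × S → ℝ := fun z => δ⁻¹ * (c 0 * a z - b 0 * b z)
  let q : Plane × S → ℝ := fun z => δ⁻¹ * (c 0 * b z - b 0 * c z)
  let r : Plane × S → ℝ := fun z => δ⁻¹ * (a 0 * b z - b 0 * a z)
  let s : Plane × S → ℝ := fun z => δ⁻¹ * (a 0 * c z - b 0 * b z)
  have k := fun x : ℝ => smoothNear_const (E := Plane × S) x
  have hp : SmoothNear p := (k _).mul (((k _).mul ha).sub ((k _).mul hb))
  have hq : SmoothNear q := (k _).mul (((k _).mul hb).sub ((k _).mul hc))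
  have hr : SmoothNear r := (k _).mul (((k _).mul hb).sub ((k _).mul ha))
  have hs : SmoothNear s := (k _).mul (((k _).mul hc).sub ((k _).mul hb))
  let D : Plane × S → ℝ := fun z => p z * s z - q z * r z
  have hD : SmoothNear D := (hp.mul hs).sub (hq.mul hr)
  have p0 : p 0 = 1 := by simp only [p]; rw [inv_mul_eq_one₀ hdet, hδ]; ring
  have q0 : q 0 = 0 := by simp only [q]; ring
  have r0 : r 0 = 0 := by simp only [r]; ring
  have s0 : s 0 = 1 := by simp only [s]; rw [inv_mul_eq_one₀ hdet, hδ]; ring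
  have D0 : D 0 = 1 := by simp [D, p0, q0, r0, s0]
  let d : Plane × S → ℝ := fun z => √(D z)
  have hd : SmoothNear d := hD.sqrt (by simp [D0])
  have d0 : d 0 = 1 := by simp [d, D0]
  let T : Plane × S → ℝ := fun z => p z + s z + 2 * d z
  have hT : SmoothNear T := (hp.add hs).add ((k _).mul hd)
  have T0 : T 0 = 4 := by simp only [T, p0, s0, d0]; norm_num
  -- The normalizing factor of the square root. At the origin tr B + 2d = 4, so the square root is
  -- (I + I)/2 = I there.
  let t : Plane × S → ℝ := fun z => (√(T z))⁻¹
  have sq4 : √(4 : ℝ) = 2 := by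
    rw [show (4 : ℝ) = 2 ^ 2 by norm_num, Real.sqrt_sq (by norm_num)]
  have t0 : t 0 = 1 / 2 := by simp only [t, T0, sq4]; norm_num
  have ht : SmoothNear t := (hT.sqrt (by simp [T0])).inv (by rw [T0, sq4]; norm_num)
  let a₁ : Plane × S → ℝ := fun z => (p z + d z) * t z
  let b₁ : Plane × S → ℝ := fun z => q z * t z
  let a₂ : Plane × S → ℝ := fun z => r z * t z
  let b₂ : Plane × S → ℝ := fun z => (s z + d z) * t z
  have ha₁ : SmoothNear a₁ := (hp.add hd).mul ht
  have hb₁ : SmoothNear b₁ := hq.mul ht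
  have ha₂ : SmoothNear a₂ := hr.mul ht
  have hb₂ : SmoothNear b₂ := (hs.add hd).mul ht
  have u := smoothNear_coord_fst (S := S)
  have v := smoothNear_coord_snd (S := S)
  have hy₁ := (u.mul ha₁).add (v.mul hb₁)
  have hy₂ := (u.mul ha₂).add (v.mul hb₂)
  refine ⟨fun z => (z.1.1 * a₁ z + z.1.2 * b₁ z, z.1.1 * a₂ z + z.1.2 * b₂ z),
    hy₁.prodMk hy₂, by simp, fun w => ?_, ?_⟩
  · have e1 := (pd_coord_combination ha₁ hb₁ (Eventually.of_forall fun _ => rfl)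
      (w, 0)).self_of_nhds
    have e2 := (pd_coord_combination ha₂ hb₂ (Eventually.of_forall fun _ => rfl)
      (w, 0)).self_of_nhds
    rw [(hy₁.differentiableAt.hasFDerivAt.prodMk hy₂.differentiableAt.hasFDerivAt).fderiv]
    simp only [pd] at e1 e2
    ext
    · simp only [ContinuousLinearMap.prod_apply, e1]
      simp [a₁, b₁, p0, q0, d0, t0]
      norm_num
    · simp only [ContinuousLinearMap.prod_apply, e2]
      simp [a₂, b₂, s0, r0, d0, t0]
      norm_num
  · have hDpos : ∀ᶠ z in 𝓝 0, 0 < D z :=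
      hD.self.continuousAt.eventually (lt_mem_nhds (by rw [D0]; norm_num))
    have hTpos : ∀ᶠ z in 𝓝 0, 0 < T z :=
      hT.self.continuousAt.eventually (lt_mem_nhds (by rw [T0]; norm_num))
    filter_upwards [hDpos, hTpos] with z h1 h2
    have hi : δ⁻¹ * δ = 1 := inv_mul_cancel₀ hdet
    have key := quadratic_form_eq_of_matrix_sqrt (a₀ := a 0) (b₀ := b 0) (c₀ := c 0) (p := p z)
      (q := q z) (r := r z) (s := s z) (d := d z) (a := a z) (b := b z) (c := c z)
      (by simp only [p, r]; linear_combination (a z) * hi + (a z) * δ⁻¹ * (-hδ))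
      (by simp only [q, s]; linear_combination (b z) * hi + (b z) * δ⁻¹ * (-hδ))
      (by simp only [p, r]; linear_combination (b z) * hi + (b z) * δ⁻¹ * (-hδ))
      (by simp only [q, s]; linear_combination (c z) * hi + (c z) * δ⁻¹ * (-hδ))
      (Real.sq_sqrt h1.le) z.1.1 z.1.2
    have hts : t z ^ 2 * T z = 1 := by
      simp only [t, inv_pow, Real.sq_sqrt h2.le]
      exact inv_mul_cancel₀ h2.ne'
    simp only [a₁, b₁, a₂, b₂]
    linear_combination (t z) ^ 2 * key +
      (a z * z.1.1 ^ 2 + 2 * b z * z.1.1 * z.1.2 + c z * z.1.2 ^ 2) * hts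

/-- Derivatives in the fibre directions are not affected by a translation depending on the
parameters. -/
theorem pd_comp_translate {F : Type*} [NormedAddCommGroup F] [NormedSpace ℝ F]
    {f : Plane × S → F} (hf : SmoothNear f) {t : S → Plane}
    (ht : SmoothNear t) (ht0 : t 0 = 0) (e : Plane) :
    ∀ᶠ z in 𝓝 (0 : Plane × S),
      pd (e, 0) (fun z => f (z.1 + t z.2, z.2)) z = pd (e, 0) f (z.1 + t z.2, z.2) := by
  have hs : Tendsto (fun z : Plane × S => z.2) (𝓝 0) (𝓝 0) := continuous_snd.tendsto' _ _ rfl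
  have hτ : Tendsto (fun z : Plane × S => (z.1 + t z.2, z.2)) (𝓝 0) (𝓝 0) := by
    have h := ((continuous_fst.tendsto (0 : Plane × S)).add ((ht.tendsto ht0).comp hs)).prodMk_nhds
      hs
    simpa [Prod.mk_zero_zero] using h
  filter_upwards [hs.eventually ht.eventually_differentiableAt,
    hτ.eventually hf.eventually_differentiableAt] with z h1 h2
  have hd : HasFDerivAt (fun z : Plane × S => (z.1 + t z.2, z.2))
      ((ContinuousLinearMap.fst ℝ Plane S +
        (fderiv ℝ t z.2).comp (ContinuousLinearMap.snd ℝ Plane S)).prod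
        (ContinuousLinearMap.snd ℝ Plane S)) z :=
    ((hasFDerivAt_fst).add (h1.hasFDerivAt.comp z hasFDerivAt_snd)).prodMk hasFDerivAt_snd
  have hc := (h2.hasFDerivAt.comp z hd).fderiv
  simp only [pd]
  change fderiv ℝ (f ∘ fun z : Plane × S => (z.1 + t z.2, z.2)) z _ = _
  rw [hc]
  simp

/-- The Morse lemma with parameters. -/
theorem exists_morse_normal_form [FiniteDimensional ℝ S] {K : Plane × S → ℝ} (hK : SmoothNear K)
    (h1 : pd ((1, 0), 0) K 0 = 0) (h2 : pd ((0, 1), 0) K 0 = 0)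
    (hdet : pd ((1, 0), 0) (pd ((1, 0), 0) K) 0 * pd ((0, 1), 0) (pd ((0, 1), 0) K) 0 -
      pd ((0, 1), 0) (pd ((1, 0), 0) K) 0 ^ 2 ≠ 0) :
    ∃ (a b c : ℝ) (y : Plane × S → Plane) (m : S → ℝ), a * c - b ^ 2 ≠ 0 ∧ SmoothNear y ∧
      SmoothNear m ∧ y 0 = 0 ∧ (∀ q, fderiv ℝ y 0 (q, 0) = q) ∧
      ∀ᶠ z in 𝓝 (0 : Plane × S),
        K z = m z.2 + (a * (y z).1 ^ 2 + 2 * b * (y z).1 * (y z).2 + c * (y z).2 ^ 2) := by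
  set e₁ : Plane × S := ((1, 0), 0) with he₁
  set e₂ : Plane × S := ((0, 1), 0) with he₂
  have hu := hK.dirDeriv e₁
  have hv := hK.dirDeriv e₂
  have hsym : pd e₁ (pd e₂ K) 0 = pd e₂ (pd e₁ K) 0 := pd_pd_comm hK.self _ _
  have hsnd : SmoothNear (fun z : Plane × S => z.2) := contDiff_snd.smoothNear
  -- The map z = (q, s) ↦ (K_u, K_v, s) is a local diffeomorphism because the Hessian in q is
  -- nondegenerate. Its inverse, restricted to the points (0, s), gives the critical point of each
  -- slice, smoothly in s.
  obtain ⟨N, hN, hN0, -, hN1⟩ := SmoothNear.exists_inverse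
    (f := fun z : Plane × S => ((pd e₁ K z, pd e₂ K z), z.2)) ((hu.prodMk hv).prodMk hsnd)
    (by simp [h1, h2]) (by
      intro w hw
      rw [((hu.differentiableAt.hasFDerivAt.prodMk hv.differentiableAt.hasFDerivAt).prodMk
        hasFDerivAt_snd).fderiv] at hw
      simp only [ContinuousLinearMap.prod_apply, Prod.mk_eq_zero,
        ContinuousLinearMap.coe_snd'] at hw
      obtain ⟨⟨w1, w2⟩, w3⟩ := hw
      have hwe : w = w.1.1 • e₁ + w.1.2 • e₂ := by
        ext <;> simp [he₁, he₂, w3]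
      rw [hwe, map_add, map_smul, map_smul] at w1 w2
      simp only [smul_eq_mul] at w1 w2
      change w.1.1 * pd e₁ (pd e₁ K) 0 + w.1.2 * pd e₂ (pd e₁ K) 0 = 0 at w1
      change w.1.1 * pd e₁ (pd e₂ K) 0 + w.1.2 * pd e₂ (pd e₂ K) 0 = 0 at w2
      rw [hsym] at w2
      have z1 : w.1.1 = 0 := by
        refine (mul_eq_zero.1 ?_).resolve_right hdet
        linear_combination pd e₂ (pd e₂ K) 0 * w1 - pd e₂ (pd e₁ K) 0 * w2
      have z2 : w.1.2 = 0 := by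
        refine (mul_eq_zero.1 ?_).resolve_right hdet
        linear_combination pd e₁ (pd e₁ K) 0 * w2 - pd e₂ (pd e₁ K) 0 * w1
      ext <;> simp [z1, z2, w3])
  have hin : Tendsto (fun s : S => ((0, s) : Plane × S)) (𝓝 0) (𝓝 0) :=
    (continuous_const.prodMk continuous_id).tendsto' _ _ rfl
  have hs : Tendsto (fun z : Plane × S => z.2) (𝓝 0) (𝓝 0) := continuous_snd.tendsto' _ _ rfl
  have hinS : SmoothNear (fun s : S => ((0, s) : Plane × S)) :=
    (contDiff_const.prodMk contDiff_id).smoothNear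
  let t : S → Plane := fun s => (N (0, s)).1
  have ht : SmoothNear t := (hN.comp hinS rfl).fst
  have ht0 : t 0 = 0 := by
    have : N (0, 0) = 0 := hN0
    simp [t, this]
  have hcrit : ∀ᶠ s in 𝓝 (0 : S), pd e₁ K (t s, s) = 0 ∧ pd e₂ K (t s, s) = 0 := by
    filter_upwards [hin.eventually hN1] with s h
    obtain ⟨h12, h3⟩ := Prod.mk.inj h
    have hz : N (0, s) = (t s, s) := Prod.ext rfl h3
    rw [hz] at h12
    exact ⟨congrArg Prod.fst h12, congrArg Prod.snd h12⟩
  let m : S → ℝ := fun s => K (t s, s)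
  have hts : SmoothNear (fun s : S => (t s, s)) := ht.prodMk contDiff_id.smoothNear
  have hm : SmoothNear m := hK.comp hts (by simp [ht0])
  have hτ : SmoothNear (fun z : Plane × S => (z.1 + t z.2, z.2)) :=
    (contDiff_fst.smoothNear.add (ht.comp hsnd rfl)).prodMk hsnd
  have hσ : SmoothNear (fun z : Plane × S => (z.1 - t z.2, z.2)) :=
    (contDiff_fst.smoothNear.sub (ht.comp hsnd rfl)).prodMk hsnd
  have hτ0 : ((0 : Plane × S).1 + t (0 : Plane × S).2, (0 : Plane × S).2) = 0 := by simp [ht0]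
  have hσ0 : ((0 : Plane × S).1 - t (0 : Plane × S).2, (0 : Plane × S).2) = 0 := by simp [ht0]
  -- Translating the critical points to the zero section and subtracting the critical values leaves
  -- a germ that vanishes to second order on that section; the Hessian at the origin does not
  -- change.
  let Kt : Plane × S → ℝ := fun z => K (z.1 + t z.2, z.2)
  have hKt : SmoothNear Kt := hK.comp hτ hτ0
  let M : Plane × S → ℝ := fun z => (-1) * m z.2
  have hM : SmoothNear M := (smoothNear_const _).mul (hm.comp hsnd rfl)
  have hMd : ∀ e : Plane, ∀ᶠ z in 𝓝 (0 : Plane × S), pd (e, 0) M z = 0 := by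
    intro e
    filter_upwards [hs.eventually hm.eventually_differentiableAt] with z hz
    have := (((hz.hasFDerivAt.comp z hasFDerivAt_snd).const_mul (-1 : ℝ))).fderiv
    have h' : fderiv ℝ M z = _ := this
    simp [pd, h']
  let L : Plane × S → ℝ := fun z => Kt z + M z
  have hL : SmoothNear L := hKt.add hM
  have hLd : ∀ e : Plane, ∀ᶠ z in 𝓝 (0 : Plane × S),
      pd (e, 0) L z = pd (e, 0) K (z.1 + t z.2, z.2) := by
    intro e
    filter_upwards [pd_comp_translate hK ht ht0 e, hMd e, hKt.eventually_differentiableAt,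
      hM.eventually_differentiableAt] with z a1 a2 a3 a4
    rw [pd_add _ a3 a4, a2, a1, add_zero]
  have hLdd : ∀ e e' : Plane, pd (e', 0) (pd (e, 0) L) 0 = pd (e', 0) (pd (e, 0) K) 0 := by
    intro e e'
    rw [pd_eq_of_eventuallyEq (e', 0) (hLd e),
      (pd_comp_translate (hK.dirDeriv (e, 0)) ht ht0 e').self_of_nhds, hτ0]
  obtain ⟨a, b, c, ha, hb, hc, hq, ea, eb, ec⟩ := hL.exists_quadratic
    (Eventually.of_forall fun s => by simp [L, Kt, M, m])
    (by
      filter_upwards [hcrit, hin.eventually (hLd (1, 0))] with s a1 a2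
      rw [a2]; simpa using a1.1)
    (by
      filter_upwards [hcrit, hin.eventually (hLd (0, 1))] with s a1 a2
      rw [a2]; simpa using a1.2)
  rw [hLdd] at ea eb ec
  have hdet' : a 0 * c 0 - b 0 ^ 2 ≠ 0 := by
    intro h
    apply hdet
    rw [he₁, he₂, ea, eb, ec]
    linear_combination 4 * h
  obtain ⟨Y, hY, hY0, hYd, hYq⟩ := exists_coordinates_quadratic ha hb hc hdet'
  refine ⟨a 0, b 0, c 0, fun z => Y (z.1 - t z.2, z.2), m, hdet', hY.comp hσ hσ0, hm, ?_, ?_, ?_⟩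
  · change Y ((0 : Plane × S).1 - t (0 : Plane × S).2, (0 : Plane × S).2) = 0
    rw [hσ0, hY0]
  · intro q
    have hneg : SmoothNear (fun s => (-1 : ℝ) • t s) := (smoothNear_const _).smul ht
    have := (pd_comp_translate hY hneg (by simp [ht0]) q).self_of_nhds
    simp only [neg_smul, one_smul, ← sub_eq_add_neg] at this
    rw [hσ0] at this
    exact this.trans (hYd q)
  · filter_upwards [(hσ.tendsto hσ0).eventually hq, (hσ.tendsto hσ0).eventually hYq] with z a1 a2
    rw [a2, ← a1]
    simp [L, Kt, M]

end Morse

/-! ### Chain rules and restriction to slices -/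

section Calculus

variable {E F G : Type*} [NormedAddCommGroup E] [NormedSpace ℝ E]
  [NormedAddCommGroup F] [NormedSpace ℝ F] [NormedAddCommGroup G] [NormedSpace ℝ G]

theorem pd_comp {f : F → G} {g : E → F} {z : E} (e : E) (hf : DifferentiableAt ℝ f (g z))
    (hg : DifferentiableAt ℝ g z) : pd e (fun z => f (g z)) z = pd (pd e g z) f (g z) := by
  have h := (hf.hasFDerivAt.comp z hg.hasFDerivAt).fderiv
  change fderiv ℝ (f ∘ g) z e = _
  rw [h]
  rfl

theorem pd_prodMk {f : E → F} {g : E → G} {z : E} (e : E) (hf : DifferentiableAt ℝ f z)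
    (hg : DifferentiableAt ℝ g z) : pd e (fun z => (f z, g z)) z = (pd e f z, pd e g z) := by
  rw [pd, (hf.hasFDerivAt.prodMk hg.hasFDerivAt).fderiv]
  rfl

theorem pd_clm (L : E →L[ℝ] F) (e z : E) : pd e (fun z => L z) z = L e := by
  rw [pd, L.fderiv]

theorem pd_zero_dir (f : E → F) (z : E) : pd 0 f z = 0 := map_zero _

theorem pd_add_dir (f : E → F) (e e' z : E) : pd (e + e') f z = pd e f z + pd e' f z :=
  map_add _ _ _

theorem pd_smul_dir (f : E → F) (c : ℝ) (e z : E) : pd (c • e) f z = c • pd e f z :=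
  map_smul _ _ _

theorem pd_plane (f : Plane → F) (e z : Plane) :
    pd e f z = e.1 • pd (1, 0) f z + e.2 • pd (0, 1) f z := by
  rw [← pd_smul_dir, ← pd_smul_dir, ← pd_add_dir]
  congr 1
  ext <;> simp

theorem fderiv_plane_eq_zero_iff {f : Plane → F} {z : Plane} :
    fderiv ℝ f z = 0 ↔ pd (1, 0) f z = 0 ∧ pd (0, 1) f z = 0 := by
  constructor
  · intro h
    simp [pd, h]
  · rintro ⟨h1, h2⟩
    refine ContinuousLinearMap.ext fun e => ?_
    have := pd_plane f e z
    rw [h1, h2, smul_zero, smul_zero, add_zero] at this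
    exact this

theorem pd_mul_eq_zero {f g : E → ℝ} {z : E} (e : E) (hf : DifferentiableAt ℝ f z)
    (hg : DifferentiableAt ℝ g z) (h1 : f z = 0) (h2 : g z = 0) :
    pd e (fun z => f z * g z) z = 0 := by
  rw [pd_mul e hf hg, h1, h2, mul_zero, zero_mul, add_zero]

/-- Derivatives along a slice are derivatives of the restriction to the slice. -/
theorem pd_slice {S : Type*} [NormedAddCommGroup S] [NormedSpace ℝ S] {K : Plane × S → F}
    {f : Plane → F} (hK : SmoothNear K) (h : ∀ᶠ q in 𝓝 (0 : Plane), K (q, 0) = f q) (e : Plane) :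
    ∀ᶠ q in 𝓝 (0 : Plane), pd (e, 0) K (q, 0) = pd e f q := by
  have hin : Tendsto (fun q : Plane => ((q, 0) : Plane × S)) (𝓝 0) (𝓝 0) :=
    (continuous_id.prodMk continuous_const).tendsto' _ _ rfl
  filter_upwards [EventuallyEq.eventuallyEq_nhds h, hin.eventually hK.eventually_differentiableAt]
    with q h1 h2
  have hd : DifferentiableAt ℝ (fun q : Plane => ((q, 0) : Plane × S)) q :=
    differentiableAt_id.prodMk (differentiableAt_const _)
  have h3 : pd e (fun q : Plane => ((q, 0) : Plane × S)) q = (e, 0) :=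
    pd_clm (ContinuousLinearMap.inl ℝ Plane S) e q
  rw [← pd_eq_of_eventuallyEq e h1, pd_comp e h2 hd, h3]

end Calculus

/-! ### A1-singularities and the Hessian determinant -/

section A1

theorem exists_sign_mul_sq {x : ℝ} (hx : x ≠ 0) :
    ∃ s k : ℝ, (s = 1 ∨ s = -1) ∧ k ≠ 0 ∧ x = s * k ^ 2 := by
  rcases lt_or_gt_of_ne hx with h | h
  · exact ⟨-1, √(-x), Or.inr rfl, (Real.sqrt_pos.2 (neg_pos.2 h)).ne',
      by rw [Real.sq_sqrt (neg_pos.2 h).le]; ring⟩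
  · exact ⟨1, √x, Or.inl rfl, (Real.sqrt_pos.2 h).ne', by rw [Real.sq_sqrt h.le]; ring⟩

/-- Sylvester's law for nondegenerate binary quadratic forms. -/
theorem exists_diagonalization {a b c : ℝ} (h : a * c - b ^ 2 ≠ 0) :
    ∃ s r p₁ p₂ p₃ p₄ : ℝ, (s = 1 ∨ s = -1) ∧ (r = 1 ∨ r = -1) ∧ p₁ * p₄ - p₂ * p₃ ≠ 0 ∧
      ∀ u v : ℝ, a * u ^ 2 + 2 * b * u * v + c * v ^ 2 =
        s * ((p₁ * u + p₂ * v) ^ 2 + r * (p₃ * u + p₄ * v) ^ 2) := by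
  have main : ∀ {a b c : ℝ}, a ≠ 0 → a * c - b ^ 2 ≠ 0 →
      ∃ s r p₁ p₂ p₄ : ℝ, (s = 1 ∨ s = -1) ∧ (r = 1 ∨ r = -1) ∧ p₁ * p₄ ≠ 0 ∧
      ∀ u v : ℝ, a * u ^ 2 + 2 * b * u * v + c * v ^ 2 =
        s * ((p₁ * u + p₂ * v) ^ 2 + r * (p₄ * v) ^ 2) := by
    intro a b c ha h
    obtain ⟨s, k, hs, hk, hsk⟩ := exists_sign_mul_sq ha
    have hss : s * s = 1 := by rcases hs with rfl | rfl <;> norm_num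
    have hs0 : s ≠ 0 := by rcases hs with rfl | rfl <;> norm_num
    obtain ⟨r, l, hr, hl, hrl⟩ := exists_sign_mul_sq (x := s * ((a * c - b ^ 2) / a))
      (mul_ne_zero hs0 (div_ne_zero h ha))
    refine ⟨s, r, k, s * b / k, l, hs, hr, mul_ne_zero hk hl, fun u v => ?_⟩
    have e1 : s * (r * l ^ 2) = c - b ^ 2 / a := by
      rw [← hrl]
      field_simp
      linear_combination hss
    have e2 : s * (s * b / k) ^ 2 = b ^ 2 / a := by
      rw [hsk]
      field_simp
      linear_combination (s ^ 2 + 1) * b ^ 2 * hss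
    have e3 : s * (k * (s * b / k)) = b := by
      field_simp
      linear_combination b * hss
    linear_combination u ^ 2 * hsk - v ^ 2 * e1 - v ^ 2 * e2 - 2 * u * v * e3
  by_cases ha : a = 0
  · by_cases hc : c = 0
    · subst ha hc
      -- Here the form is 2b uv = (b/2)((u + v)² - (u - v)²).
      have hb : b / 2 ≠ 0 := by
        rintro h0
        apply h
        rw [show b = 0 by linarith]
        ring
      obtain ⟨s, k, hs, hk, hsk⟩ := exists_sign_mul_sq hb
      refine ⟨s, -1, k, k, k, -k, hs, Or.inr rfl, ?_, fun u v => ?_⟩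
      · have : k * -k - k * k = -2 * k ^ 2 := by ring
        rw [this]
        exact mul_ne_zero (by norm_num) (pow_ne_zero 2 hk)
      · linear_combination 4 * u * v * hsk
    · obtain ⟨s, r, p₁, p₂, p₄, hs, hr, hp, hq⟩ := main (a := c) (b := b) (c := a) hc
        (by rwa [mul_comm])
      refine ⟨s, r, p₂, p₁, p₄, 0, hs, hr, ?_, fun u v => ?_⟩
      · rw [mul_zero, zero_sub]
        exact neg_ne_zero.2 hp
      · linear_combination hq v u
  · obtain ⟨s, r, p₁, p₂, p₄, hs, hr, hp, hq⟩ := main ha h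
    refine ⟨s, r, p₁, p₂, 0, p₄, hs, hr, by simpa using hp, fun u v => ?_⟩
    linear_combination hq u v

theorem smoothNear_slice {F S : Type*} [NormedAddCommGroup F] [NormedSpace ℝ F]
    [NormedAddCommGroup S] [NormedSpace ℝ S] {K : Plane × S → F} (hK : SmoothNear K) :
    SmoothNear (fun q => K (q, 0)) :=
  hK.comp (f := fun q : Plane => ((q, 0) : Plane × S))
    (contDiff_id.prodMk contDiff_const).smoothNear rfl

/-- The Morse normal form of a deformation of a nondegenerate critical point. -/
theorem exists_morse_of_deformation {S : Type*} [NormedAddCommGroup S] [NormedSpace ℝ S]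
    [FiniteDimensional ℝ S] {f : Plane → ℝ} {K : Plane × S → ℝ} (hK : IsDeformation f K)
    (h1 : fderiv ℝ f 0 = 0) (hdet : hessDet f ≠ 0) :
    ∃ (a b c : ℝ) (y : Plane × S → Plane) (m : S → ℝ), a * c - b ^ 2 ≠ 0 ∧ SmoothNear y ∧
      SmoothNear m ∧ y 0 = 0 ∧ (∀ q, fderiv ℝ y 0 (q, 0) = q) ∧
      ∀ᶠ z in 𝓝 (0 : Plane × S),
        K z = m z.2 + (a * (y z).1 ^ 2 + 2 * b * (y z).1 * (y z).2 + c * (y z).2 ^ 2) := by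
  obtain ⟨hs, hf⟩ := hK
  have e1 := fun e => (pd_slice hs hf e)
  have e2 := fun e e' => (pd_slice (hs.dirDeriv (e, 0)) (e1 e) e').self_of_nhds
  obtain ⟨c1, c2⟩ := fderiv_plane_eq_zero_iff.1 h1
  refine exists_morse_normal_form hs ((e1 _).self_of_nhds.trans c1)
    ((e1 _).self_of_nhds.trans c2) ?_
  simp only [hessDet, ← e2] at hdet
  exact hdet

/-- The Morse normal form of the constant deformation, restricted to parameter 0, followed by a
linear diagonalization of the quadratic form. -/
theorem isA1_of_hessDet_ne_zero {f : Plane → ℝ} (hf : SmoothNear f) (h0 : f 0 = 0)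
    (h1 : fderiv ℝ f 0 = 0) (hdet : hessDet f ≠ 0) : IsA1 f := by
  obtain ⟨a, b, c, y, m, hd, hy, -, hy0, hyd, hq⟩ := exists_morse_of_deformation
    (S := ℝ) (K := fun z => f z.1) ⟨hf.comp contDiff_fst.smoothNear rfl,
      Eventually.of_forall fun _ => rfl⟩ h1 hdet
  have hm0 : m 0 = 0 := by
    have := hq.self_of_nhds
    simpa [hy0, h0] using this.symm
  obtain ⟨s, r, p₁, p₂, p₃, p₄, hs, hr, hp, hquad⟩ := exists_diagonalization hd
  have hin : Tendsto (fun q : Plane => ((q, 0) : Plane × ℝ)) (𝓝 0) (𝓝 0) :=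
    (continuous_id.prodMk continuous_const).tendsto' _ _ rfl
  let P : Plane →L[ℝ] Plane :=
    (p₁ • ContinuousLinearMap.fst ℝ ℝ ℝ + p₂ • ContinuousLinearMap.snd ℝ ℝ ℝ).prod
      (p₃ • ContinuousLinearMap.fst ℝ ℝ ℝ + p₄ • ContinuousLinearMap.snd ℝ ℝ ℝ)
  have hy' : SmoothNear (fun q : Plane => y (q, 0)) := smoothNear_slice hy
  have hφ : SmoothNear (fun q : Plane => P (y (q, 0))) := P.contDiff.smoothNear.comp hy' hy0
  have hφ0 : P (y (0, 0)) = 0 := by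
    have : y (0, 0) = 0 := hy0
    rw [this, map_zero]
  refine ⟨s, r, hs, hr, fun q => P (y (q, 0)), ⟨hφ, hφ0, hφ.exists_inverse hφ0 ?_⟩, ?_⟩
  · intro v hv
    have e1 : fderiv ℝ (fun q : Plane => y (q, 0)) 0 v = v :=
      ((pd_slice hy (Eventually.of_forall fun _ => rfl) v).self_of_nhds).symm.trans (hyd v)
    have e2 : pd v (fun q : Plane => P (y (q, 0))) 0 = P v := by
      rw [pd_comp v P.differentiableAt hy'.differentiableAt]
      simp only [pd, e1, P.fderiv]
    have e3 : P v = 0 := e2.symm.trans hv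
    have e4 : p₁ * v.1 + p₂ * v.2 = 0 := congrArg Prod.fst e3
    have e5 : p₃ * v.1 + p₄ * v.2 = 0 := congrArg Prod.snd e3
    ext
    · refine (mul_eq_zero.1 ?_).resolve_left hp
      linear_combination p₄ * e4 - p₂ * e5
    · refine (mul_eq_zero.1 ?_).resolve_left hp
      linear_combination p₁ * e5 - p₃ * e4
  · filter_upwards [hin.eventually hq] with q h
    simp only [hm0, zero_add] at h
    rw [h, hquad]
    simp [P]

/-- The effect of a change of coordinates, and of the multiplication by a function, on the 2-jet of
a function at a critical point on its zero set. -/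
theorem hessDet_mul_comp {h j k : Plane → ℝ} {φ : Plane → Plane} (hh : SmoothNear h)
    (hj : SmoothNear j) (hφ : SmoothNear φ) (hφ0 : φ 0 = 0)
    (hk : ∀ᶠ q in 𝓝 0, k q = j q * h (φ q)) (h0 : h 0 = 0) (h1 : fderiv ℝ h 0 = 0) :
    k 0 = 0 ∧ fderiv ℝ k 0 = 0 ∧ hessDet k = j 0 ^ 2 *
      ((pd (1, 0) φ 0).1 * (pd (0, 1) φ 0).2 - (pd (1, 0) φ 0).2 * (pd (0, 1) φ 0).1) ^ 2 *
      hessDet h := by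
  obtain ⟨c1, c2⟩ := fderiv_plane_eq_zero_iff.1 h1
  have hhφ : SmoothNear (fun q => h (φ q)) := hh.comp hφ hφ0
  have hhu := (hh.dirDeriv (1, 0)).comp hφ hφ0
  have hhv := (hh.dirDeriv (0, 1)).comp hφ hφ0
  have hsym : pd (1, 0) (pd (0, 1) h) 0 = pd (0, 1) (pd (1, 0) h) 0 := pd_pd_comm hh.self _ _
  have pk : ∀ e : Plane, ∀ᶠ q in 𝓝 (0 : Plane), pd e k q = pd e j q * h (φ q) +
      j q * ((pd e φ q).1 * pd (1, 0) h (φ q) + (pd e φ q).2 * pd (0, 1) h (φ q)) := by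
    intro e
    filter_upwards [EventuallyEq.eventuallyEq_nhds hk, hj.eventually_differentiableAt,
      hhφ.eventually_differentiableAt, hφ.eventually_differentiableAt,
      (hφ.tendsto hφ0).eventually hh.eventually_differentiableAt] with q a1 a2 a3 a4 a5
    rw [pd_eq_of_eventuallyEq e a1, pd_mul e a2 a3, pd_comp e a5 a4, pd_plane h]
    rfl
  have pk0 : ∀ e : Plane, pd e k 0 = 0 := by
    intro e
    rw [(pk e).self_of_nhds, hφ0, h0, c1, c2]
    ring
  have pkk : ∀ e e' : Plane, pd e' (pd e k) 0 = j 0 *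
      ((pd e φ 0).1 * ((pd e' φ 0).1 * pd (1, 0) (pd (1, 0) h) 0 +
        (pd e' φ 0).2 * pd (0, 1) (pd (1, 0) h) 0) +
       (pd e φ 0).2 * ((pd e' φ 0).1 * pd (0, 1) (pd (1, 0) h) 0 +
        (pd e' φ 0).2 * pd (0, 1) (pd (0, 1) h) 0)) := by
    intro e e'
    have d1 := (hφ.dirDeriv e).fst.differentiableAt
    have d2 := (hφ.dirDeriv e).snd.differentiableAt
    have ch : ∀ g : Plane → ℝ, SmoothNear g → pd e' (fun q => g (φ q)) 0 =
        (pd e' φ 0).1 * pd (1, 0) g 0 + (pd e' φ 0).2 * pd (0, 1) g 0 := by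
      intro g hg
      rw [pd_comp e' (by rw [hφ0]; exact hg.differentiableAt) hφ.differentiableAt, pd_plane g, hφ0]
      rfl
    rw [pd_eq_of_eventuallyEq e' (pk e),
      pd_add e' ((hj.dirDeriv e).differentiableAt.fun_mul hhφ.differentiableAt)
        (hj.differentiableAt.fun_mul ((d1.fun_mul hhu.differentiableAt).fun_add
          (d2.fun_mul hhv.differentiableAt))),
      pd_mul e' (hj.dirDeriv e).differentiableAt hhφ.differentiableAt,
      pd_mul e' hj.differentiableAt ((d1.fun_mul hhu.differentiableAt).fun_add
          (d2.fun_mul hhv.differentiableAt)),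
      pd_add e' (d1.fun_mul hhu.differentiableAt) (d2.fun_mul hhv.differentiableAt),
      pd_mul e' d1 hhu.differentiableAt, pd_mul e' d2 hhv.differentiableAt,
      ch h hh, ch _ (hh.dirDeriv (1, 0)), ch _ (hh.dirDeriv (0, 1)), hφ0, h0, c1, c2, hsym]
    ring
  refine ⟨?_, fderiv_plane_eq_zero_iff.2 ⟨pk0 _, pk0 _⟩, ?_⟩
  · rw [hk.self_of_nhds, hφ0, h0, mul_zero]
  · rw [hessDet, hessDet, pkk, pkk, pkk]
    ring

theorem pd_coord_one (e z : Plane) : pd e (fun q : Plane => q.1) z = e.1 :=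
  pd_clm (ContinuousLinearMap.fst ℝ ℝ ℝ) e z

theorem pd_coord_two (e z : Plane) : pd e (fun q : Plane => q.2) z = e.2 :=
  pd_clm (ContinuousLinearMap.snd ℝ ℝ ℝ) e z

theorem pd_const_mul {E : Type*} [NormedAddCommGroup E] [NormedSpace ℝ E] {f : E → ℝ} {z : E}
    (e : E) (c : ℝ) (hf : DifferentiableAt ℝ f z) :
    pd e (fun z => c * f z) z = c * pd e f z := by
  rw [pd_mul e (differentiableAt_const c) hf, pd_const, zero_mul, zero_add]

theorem hessDet_standard (s r : ℝ) :
    hessDet (fun q : Plane => s * (q.1 ^ 2 + r * q.2 ^ 2)) = 4 * s ^ 2 * r := by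
  have hp : ∀ e : Plane, pd e (fun q : Plane => s * (q.1 ^ 2 + r * q.2 ^ 2)) =
      fun q => (2 * s * e.1) * q.1 + (2 * s * r * e.2) * q.2 := by
    intro e
    ext q
    have h1 : HasFDerivAt (fun q : Plane => q.1) (ContinuousLinearMap.fst ℝ ℝ ℝ) q := hasFDerivAt_fst
    have h2 : HasFDerivAt (fun q : Plane => q.2) (ContinuousLinearMap.snd ℝ ℝ ℝ) q := hasFDerivAt_snd
    have h := (((h1.pow 2).fun_add ((h2.pow 2).const_mul r)).const_mul s).fderiv
    simp only [pd]
    rw [h]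
    simp
    ring
  have hpp : ∀ e e' : Plane, pd e' (pd e (fun q : Plane => s * (q.1 ^ 2 + r * q.2 ^ 2))) 0 =
      (2 * s * e.1) * e'.1 + (2 * s * r * e.2) * e'.2 := by
    intro e e'
    rw [hp, pd_add e' (by fun_prop) (by fun_prop), pd_const_mul e' _ (by fun_prop),
      pd_const_mul e' _ (by fun_prop), pd_coord_one, pd_coord_two]
  simp only [hessDet, hpp]
  ring

theorem IsA1.hessDet_ne_zero {f : Plane → ℝ} (hA : IsA1 f) (hf : SmoothNear f) (h0 : f 0 = 0)
    (h1 : fderiv ℝ f 0 = 0) : hessDet f ≠ 0 := by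
  obtain ⟨s, r, hs, hr, hR⟩ := hA
  -- The normal form is expressed through `f`, not conversely: degeneracy of `f` then passes to the
  -- normal form whatever the Jacobian of `φ` is.
  obtain ⟨φ, ⟨hφ, hφ0, -⟩, hk⟩ := hR.symm
  intro hdet
  have h := (hessDet_mul_comp hf (smoothNear_const 1) hφ hφ0
    (by simpa using hk) h0 h1).2.2
  rw [hdet, mul_zero, hessDet_standard] at h
  have hs0 : s ≠ 0 := by rcases hs with rfl | rfl <;> norm_num
  have hr0 : r ≠ 0 := by rcases hr with rfl | rfl <;> norm_num
  exact mul_ne_zero (mul_ne_zero four_ne_zero (pow_ne_zero 2 hs0)) hr0 h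

end A1

/-! ### Versality of 1-parameter deformations of a nondegenerate critical point -/

section Versal

/-- A 1-parameter deformation of a nondegenerate critical point, with nonzero velocity there, induces
every other deformation. -/
theorem exists_inducing_map {S : Type*} [NormedAddCommGroup S] [NormedSpace ℝ S]
    [FiniteDimensional ℝ S] {f : Plane → ℝ} {F : Plane × ℝ → ℝ} (hF : IsDeformation f F)
    (h1 : fderiv ℝ f 0 = 0) (hdet : hessDet f ≠ 0) (hne : pd (0, 1) F 0 ≠ 0)
    {G : Plane × S → ℝ} (hG : IsDeformation f G) :
    ∃ (φ : Plane × S → Plane) (ψ : S → ℝ), SmoothNear φ ∧ SmoothNear ψ ∧ ψ 0 = 0 ∧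
      (∀ᶠ q in 𝓝 (0 : Plane), φ (q, 0) = q) ∧
      (∀ᶠ z in 𝓝 (0 : Plane × S), G z = F (φ z, ψ z.2)) := by
  have hF0 : SmoothNear (fun q : Plane => F (q, 0)) := smoothNear_slice hF.1
  have k1 : SmoothNear (fun z : Plane × (S × ℝ) => G (z.1, z.2.1)) :=
    hG.1.comp (contDiff_fst.prodMk contDiff_snd.fst).smoothNear rfl
  have k2 : SmoothNear (fun z : Plane × (S × ℝ) => F (z.1, z.2.2)) :=
    hF.1.comp (contDiff_fst.prodMk contDiff_snd.snd).smoothNear rfl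
  have k3 : SmoothNear (fun z : Plane × (S × ℝ) => F (z.1, 0)) :=
    hF0.comp contDiff_fst.smoothNear rfl
  -- A common deformation that restricts to `G` for t = 0 and to `F` for s = 0. One normal form for
  -- `K` treats both with the same quadratic form, so it remains to match critical values (by `ψ`)
  -- and coordinates (by `φ`).
  let K : Plane × (S × ℝ) → ℝ := fun z => G (z.1, z.2.1) + F (z.1, z.2.2) - F (z.1, 0)
  have hK : SmoothNear K := (k1.add k2).sub k3
  obtain ⟨a, b, c, y, m, -, hy, hm, hy0, hyd, hq⟩ := exists_morse_of_deformation (f := f) (K := K)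
    ⟨hK, by filter_upwards [hG.2] with q h; simp [K, h]⟩ h1 hdet
  -- the inverse of `t ↦ m (0, t) - m 0`
  have hmt : SmoothNear (fun t : ℝ => m (0, t)) :=
    hm.comp (f := fun t : ℝ => ((0, t) : S × ℝ)) (contDiff_const.prodMk contDiff_id).smoothNear rfl
  have hms : SmoothNear (fun s : S => m (s, 0)) :=
    hm.comp (f := fun s : S => ((s, 0) : S × ℝ)) (contDiff_id.prodMk contDiff_const).smoothNear rfl
  have hmd : pd (1 : ℝ) (fun t : ℝ => m (0, t)) 0 = pd (0, 1) F 0 := by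
    have ht : SmoothNear (fun t : ℝ => ((0, (0, t)) : Plane × (S × ℝ))) :=
      (contDiff_const.prodMk (contDiff_const.prodMk contDiff_id)).smoothNear
    have hFt : SmoothNear (fun t : ℝ => F (0, t)) :=
      hF.1.comp (f := fun t : ℝ => ((0, t) : Plane × ℝ))
        (contDiff_const.prodMk contDiff_id).smoothNear rfl
    have hin := ht.tendsto rfl
    have hyt : SmoothNear (fun t : ℝ => y (0, (0, t))) := hy.comp ht rfl
    have hyt0 : y (0, (0, 0)) = 0 := hy0
    have c0 := fun x : ℝ => differentiableAt_const (𝕜 := ℝ) (x := (0 : ℝ)) x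
    -- Along q = 0 the function F differs from m by a constant and terms quadratic in y, which
    -- vanishes at t = 0. Hence the critical value has the same velocity as F.
    have e1 : (fun t : ℝ => F (0, t)) =ᶠ[𝓝 0] fun t => (m (0, t) + (F (0, 0) - G (0, 0))) +
        ((a * (y (0, (0, t))).1) * (y (0, (0, t))).1 +
          (2 * b * (y (0, (0, t))).1) * (y (0, (0, t))).2 +
          (c * (y (0, (0, t))).2) * (y (0, (0, t))).2) := by
      filter_upwards [hin.eventually hq] with t h
      simp only [K] at h
      have h' : F (0, t) = (G (0, 0) + F (0, t) - F (0, 0)) + (F (0, 0) - G (0, 0)) := by ring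
      change F (0, t) = _
      rw [h', show (0 : Plane) = ((0, (0, t)) : Plane × (S × ℝ)).1 from rfl]
      linear_combination h
    have d1 := hyt.fst.differentiableAt
    have d2 := hyt.snd.differentiableAt
    have q1 : pd (1 : ℝ) (fun t : ℝ => F (0, t)) 0 = pd (0, 1) F 0 := by
      have hd : DifferentiableAt ℝ (fun t : ℝ => ((0, t) : Plane × ℝ)) 0 :=
        (differentiableAt_const _).prodMk differentiableAt_id
      rw [pd_comp (g := fun t : ℝ => ((0, t) : Plane × ℝ)) 1 hF.1.differentiableAt hd,
        show pd (1 : ℝ) (fun t : ℝ => ((0, t) : Plane × ℝ)) 0 = (0, 1) from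
          pd_clm (ContinuousLinearMap.inr ℝ Plane ℝ) 1 0]
      rfl
    rw [← q1, pd_eq_of_eventuallyEq 1 e1,
      pd_add 1 (hmt.differentiableAt.fun_add (c0 _))
        (((((c0 _).fun_mul d1).fun_mul d1).fun_add (((c0 _).fun_mul d1).fun_mul d2)).fun_add
          (((c0 _).fun_mul d2).fun_mul d2)),
      pd_add 1 hmt.differentiableAt (c0 _), pd_const,
      pd_add 1 ((((c0 _).fun_mul d1).fun_mul d1).fun_add (((c0 _).fun_mul d1).fun_mul d2))
          (((c0 _).fun_mul d2).fun_mul d2),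
      pd_add 1 (((c0 _).fun_mul d1).fun_mul d1) (((c0 _).fun_mul d1).fun_mul d2),
      pd_mul_eq_zero 1 ((c0 _).fun_mul d1) d1 (by simp [hyt0]) (by simp [hyt0]),
      pd_mul_eq_zero 1 ((c0 _).fun_mul d1) d2 (by simp [hyt0]) (by simp [hyt0]),
      pd_mul_eq_zero 1 ((c0 _).fun_mul d2) d2 (by simp [hyt0]) (by simp [hyt0])]
    ring
  obtain ⟨η, hη, hη0, -, hη1⟩ := SmoothNear.exists_inverse
    (f := fun t : ℝ => m (0, t) + -m 0) (hmt.add (smoothNear_const _))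
    (by change m 0 + -m 0 = 0; ring) (by
      intro v hv
      have e1 : pd v (fun t : ℝ => m (0, t) + -m 0) 0 = v * pd (0, 1) F 0 := by
        rw [pd_add v hmt.differentiableAt (differentiableAt_const _), pd_const, ← hmd,
          ← smul_eq_mul, ← pd_smul_dir, smul_eq_mul, mul_one, add_zero]
      exact (mul_eq_zero.1 (e1.symm.trans hv)).resolve_right hne)
  have hms' : SmoothNear (fun s : S => m (s, 0) + -m 0) := hms.add (smoothNear_const _)
  have hms0 : m ((0 : S), 0) + -m 0 = 0 := by change m 0 + -m 0 = 0; ring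
  let ψ : S → ℝ := fun s => η (m (s, 0) + -m 0)
  have hψ : SmoothNear ψ := hη.comp hms' hms0
  have hψ0 : ψ 0 = 0 := by simp only [ψ]; rw [hms0, hη0]
  have hmψ : ∀ᶠ s in 𝓝 (0 : S), m (0, ψ s) = m (s, 0) := by
    filter_upwards [(hms'.tendsto hms0).eventually hη1] with s h
    simpa using h
  -- the inverse of `(q, t) ↦ (y (q, 0, t), t)`
  have hYs : SmoothNear (fun w : Plane × ℝ => y (w.1, (0, w.2))) :=
    hy.comp (f := fun w : Plane × ℝ => ((w.1, (0, w.2)) : Plane × (S × ℝ)))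
      (contDiff_fst.prodMk (contDiff_const.prodMk contDiff_snd)).smoothNear rfl
  obtain ⟨Z, hZ, hZ0, hZ1, hZ2⟩ := SmoothNear.exists_inverse
    (f := fun w : Plane × ℝ => (y (w.1, (0, w.2)), w.2))
    (hYs.prodMk contDiff_snd.smoothNear) (Prod.ext hy0 rfl) (by
      intro v hv
      have hv' : pd v (fun w : Plane × ℝ => (y (w.1, (0, w.2)), w.2)) 0 = 0 := hv
      rw [pd_prodMk v hYs.differentiableAt differentiableAt_snd] at hv'
      have v2 : v.2 = 0 := (pd_clm (ContinuousLinearMap.snd ℝ Plane ℝ) v 0).symm.trans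
        (congrArg Prod.snd hv')
      have hve : v = (v.1, 0) := Prod.ext rfl v2
      have e1 := congrArg Prod.fst hv'
      rw [hve] at e1
      have e3 := (pd_slice hYs (Eventually.of_forall fun _ => rfl) v.1).self_of_nhds
      have e2 : pd v.1 (fun q : Plane => y (q, ((0 : S), (0 : ℝ)))) 0 = v.1 :=
        ((pd_slice hy (Eventually.of_forall fun _ => rfl) v.1).self_of_nhds).symm.trans (hyd v.1)
      exact Prod.ext (e2.symm.trans (e3.symm.trans e1)) v2)
  have hyS : SmoothNear (fun z : Plane × S => y (z.1, (z.2, 0))) :=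
    hy.comp (f := fun z : Plane × S => ((z.1, (z.2, 0)) : Plane × (S × ℝ)))
      (contDiff_fst.prodMk (contDiff_snd.prodMk contDiff_const)).smoothNear rfl
  have hψs : SmoothNear (fun z : Plane × S => ψ z.2) := hψ.comp contDiff_snd.smoothNear rfl
  have hW : SmoothNear (fun z : Plane × S => (y (z.1, (z.2, 0)), ψ z.2)) := hyS.prodMk hψs
  have hW0 : (y ((0 : Plane × S).1, ((0 : Plane × S).2, 0)), ψ (0 : Plane × S).2) = 0 :=
    Prod.ext hy0 hψ0
  -- Solves y (φ (q, s), 0, ψ s) = y (q, s, 0). At s = 0 the two sides use the same coordinates,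
  -- which gives φ (q, 0) = q.
  let φ : Plane × S → Plane := fun z => (Z (y (z.1, (z.2, 0)), ψ z.2)).1
  have hφ : SmoothNear φ := (hZ.comp hW hW0).fst
  have hφ0 : φ 0 = 0 := by
    change (Z (y ((0 : Plane × S).1, ((0 : Plane × S).2, 0)), ψ (0 : Plane × S).2)).1 = 0
    rw [hW0, hZ0]
    rfl
  refine ⟨φ, ψ, hφ, hψ, hψ0, ?_, ?_⟩
  · have hin : Tendsto (fun q : Plane => ((q, 0) : Plane × ℝ)) (𝓝 0) (𝓝 0) :=
      (continuous_id.prodMk continuous_const).tendsto' _ _ rfl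
    filter_upwards [hin.eventually hZ1] with q h
    simp only [φ, hψ0]
    exact congrArg Prod.fst h
  · have hs2 : Tendsto (fun z : Plane × S => z.2) (𝓝 0) (𝓝 0) :=
      continuous_snd.tendsto' _ _ rfl
    have t1 : Tendsto (fun z : Plane × S => ((z.1, (z.2, 0)) : Plane × (S × ℝ))) (𝓝 0) (𝓝 0) :=
      (continuous_fst.prodMk (continuous_snd.prodMk continuous_const)).tendsto' _ _ rfl
    have t2 : Tendsto (fun z : Plane × S => ((φ z, (0, ψ z.2)) : Plane × (S × ℝ))) (𝓝 0) (𝓝 0) := by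
      have h := (hφ.tendsto hφ0).prodMk_nhds
        ((tendsto_const_nhds (x := (0 : S))).prodMk_nhds (hψs.tendsto hψ0))
      exact h
    filter_upwards [t1.eventually hq, t2.eventually hq, hs2.eventually hmψ,
      (hφ.tendsto hφ0).eventually hG.2, (hφ.tendsto hφ0).eventually hF.2,
      (hW.tendsto hW0).eventually hZ2] with z a1 a2 a3 a4 a5 a6
    obtain ⟨a7, a8⟩ := Prod.mk.inj a6
    rw [a8] at a7
    have a9 : y (φ z, (0, ψ z.2)) = y (z.1, (z.2, 0)) := a7
    simp only [K] at a1 a2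
    rw [a9, a3] at a2
    have a4' : G (φ z, 0) = f (φ z) := a4
    have a5' : F (φ z, 0) = f (φ z) := a5
    rw [a4', a5'] at a2
    have : G z = G (z.1, z.2) := rfl
    linarith

/-- A 1-parameter deformation of a nondegenerate critical point is versal if and only if its
velocity does not vanish at the critical point. -/
theorem isRVersal_iff_of_hessDet_ne_zero {f : Plane → ℝ} {F : Plane × ℝ → ℝ}
    (hF : IsDeformation f F) (h1 : fderiv ℝ f 0 = 0) (hdet : hessDet f ≠ 0) :
    IsRVersal f F ↔ pd (0, 1) F 0 ≠ 0 := by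
  have hF0 : SmoothNear (fun q : Plane => F (q, 0)) := smoothNear_slice hF.1
  constructor
  · rintro ⟨-, hv⟩ hzero
    have hproj : SmoothNear (fun z : Plane × (Fin 1 → ℝ) => z.2 0) :=
      ((contDiff_apply ℝ ℝ (0 : Fin 1)).comp contDiff_snd).smoothNear
    have hF0' : SmoothNear (fun z : Plane × (Fin 1 → ℝ) => F (z.1, 0)) :=
      hF0.comp contDiff_fst.smoothNear rfl
    -- Test on the deformation f + s. Differentiating the inducing identity in s at the origin gives
    -- 1 = df(φ') + ψ' ∂F/∂t. The first term is zero at a critical point, so ∂F/∂t cannot vanish.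
    obtain ⟨φ, ψ, hφ, hψ, hψ0, hφ0, hG⟩ := hv 1 (fun z => F (z.1, 0) + z.2 0)
      ⟨hF0'.add hproj, by simpa using hF.2⟩
    have hφ00 : φ 0 = 0 := hφ0.self_of_nhds
    let e : Plane × (Fin 1 → ℝ) := (0, 1)
    have hψs : SmoothNear (fun z : Plane × (Fin 1 → ℝ) => ψ z.2) :=
      hψ.comp contDiff_snd.smoothNear rfl
    have l1 : pd e (fun z : Plane × (Fin 1 → ℝ) => F (z.1, 0) + z.2 0) 0 = 1 := by
      rw [pd_add e hF0'.differentiableAt hproj.differentiableAt,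
        pd_comp (f := fun q : Plane => F (q, 0)) (g := fun z : Plane × (Fin 1 → ℝ) => z.1) e
          hF0.differentiableAt differentiableAt_fst,
        show pd e (fun z : Plane × (Fin 1 → ℝ) => z.1) 0 = 0 from
          pd_clm (ContinuousLinearMap.fst ℝ Plane (Fin 1 → ℝ)) e 0,
        show pd e (fun z : Plane × (Fin 1 → ℝ) => z.2 0) 0 = 1 from
          pd_clm ((ContinuousLinearMap.proj (R := ℝ) (φ := fun _ : Fin 1 => ℝ) 0).comp
            (ContinuousLinearMap.snd ℝ Plane (Fin 1 → ℝ))) e 0]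
      simp [pd_zero_dir]
    rw [pd_eq_of_eventuallyEq e hG, pd_comp (g := fun z => (φ z, ψ z.2)) e
      (by simp only [hφ00, Prod.snd_zero, hψ0]; exact hF.1.differentiableAt)
      (hφ.differentiableAt.prodMk hψs.differentiableAt),
      pd_prodMk e hφ.differentiableAt hψs.differentiableAt] at l1
    simp only [hφ00, Prod.snd_zero, hψ0] at l1
    set q := pd e φ 0
    set τ := pd e (fun z : Plane × (Fin 1 → ℝ) => ψ z.2) 0
    have hqτ : (q, τ) = (q, 0) + τ • ((0, 1) : Plane × ℝ) := by ext <;> simp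
    have hq : pd (q, 0) F 0 = 0 := by
      refine ((pd_slice hF.1 hF.2 q).self_of_nhds).trans ?_
      simp [pd, h1]
    have l2 : pd (q, τ) F 0 = 1 := l1
    rw [hqτ, pd_add_dir, pd_smul_dir, hq, hzero] at l2
    simp at l2
  · intro hne
    exact ⟨hF, fun k G hG => exists_inducing_map hF h1 hdet hne hG⟩

end Versal

/-! ### Continuous dependence of jets on the germ -/

section ContinuousFamilies

variable {E F G : Type*} [NormedAddCommGroup E] [NormedSpace ℝ E]
  [NormedAddCommGroup F] [NormedSpace ℝ F] [NormedAddCommGroup G] [NormedSpace ℝ G]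

/-- Iterated directional derivatives. -/
noncomputable def dirs : List E → (E → F) → E → F
  | [], f => f
  | e :: l, f => dirs l (pd e f)

theorem dirs_eq_of_eventuallyEq (l : List E) {f g : E → F} {z : E} (h : f =ᶠ[𝓝 z] g) :
    dirs l f z = dirs l g z := by
  induction l generalizing f g with
  | nil => exact h.self_of_nhds
  | cons e l ih => exact ih (pd_eventuallyEq e h)

theorem dirs_add (l : List E) {f g : E → F} (hf : SmoothNear f) (hg : SmoothNear g) :
    dirs l (fun z => f z + g z) 0 = dirs l f 0 + dirs l g 0 := by
  induction l generalizing f g with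
  | nil => rfl
  | cons e l ih =>
    have h : pd e (fun z => f z + g z) =ᶠ[𝓝 0] fun z => pd e f z + pd e g z := by
      filter_upwards [hf.eventually_differentiableAt, hg.eventually_differentiableAt]
        with z h1 h2 using pd_add e h1 h2
    exact (dirs_eq_of_eventuallyEq l h).trans (ih (hf.dirDeriv e) (hg.dirDeriv e))

theorem pd_clm_comp (A : F →L[ℝ] G) {f : E → F} {z : E} (e : E) (hf : DifferentiableAt ℝ f z) :
    pd e (fun z => A (f z)) z = A (pd e f z) := by
  rw [pd_comp e A.differentiableAt hf]
  exact pd_clm A _ _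

theorem dirs_clm_comp (A : F →L[ℝ] G) (l : List E) {f : E → F} (hf : SmoothNear f) :
    dirs l (fun z => A (f z)) 0 = A (dirs l f 0) := by
  induction l generalizing f with
  | nil => rfl
  | cons e l ih =>
    have h : pd e (fun z => A (f z)) =ᶠ[𝓝 0] fun z => A (pd e f z) := by
      filter_upwards [hf.eventually_differentiableAt] with z h1 using pd_clm_comp A e h1
    exact (dirs_eq_of_eventuallyEq l h).trans (ih (hf.dirDeriv e))

theorem exists_dirs_eq_iteratedFDeriv (l : List E) : ∃ m : Fin l.length → E,
    ∀ f : E → F, ContDiffAt ℝ ∞ f 0 → dirs l f 0 = iteratedFDeriv ℝ l.length f 0 m := by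
  induction l with
  | nil => exact ⟨Fin.elim0, fun f _ => by simp [dirs]⟩
  | cons e l ih =>
    obtain ⟨m, hm⟩ := ih
    -- `dirs` differentiates first along the head of the list, and the innermost derivative in
    -- `iteratedFDeriv` takes the last argument; so `e` goes last.
    refine ⟨Fin.snoc (α := fun _ => E) m e, fun f hf => ?_⟩
    have hfd : ContDiffAt ℝ ∞ (fderiv ℝ f) 0 := hf.fderiv_right (m := ∞) (by simp)
    have hpd : ContDiffAt ℝ ∞ (pd e f) 0 := hfd.clm_apply contDiffAt_const
    have h1 : dirs (e :: l) f 0 = iteratedFDeriv ℝ l.length (pd e f) 0 m := hm _ hpd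
    have h2 : pd e f = ContinuousLinearMap.apply ℝ F e ∘ fderiv ℝ f := rfl
    rw [h1, h2, ContinuousLinearMap.iteratedFDeriv_comp_left (n := ∞) _ hfd
      (by exact_mod_cast le_top)]
    change _ = iteratedFDeriv ℝ (l.length + 1) f 0 _
    rw [iteratedFDeriv_succ_apply_right, Fin.init_snoc, Fin.snoc_last]
    rfl

/-- A family of smooth germs all of whose derivatives at the origin depend continuously on the
parameter. -/
def ContFam {α : Type*} [TopologicalSpace α] (T : α → E → F) : Prop :=
  (∀ x, SmoothNear (T x)) ∧ ∀ l : List E, Continuous fun x => dirs l (T x) 0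

variable {α : Type*} [TopologicalSpace α]

theorem ContFam.congr {T T' : α → E → F} (hT : ContFam T) (h : ∀ x, T x =ᶠ[𝓝 0] T' x) :
    ContFam T' :=
  ⟨fun x => (hT.1 x).congr (h x), fun l => by
    simpa only [dirs_eq_of_eventuallyEq l (h _)] using hT.2 l⟩

theorem contFam_const {f : E → F} (hf : SmoothNear f) : ContFam (fun _ : α => f) :=
  ⟨fun _ => hf, fun _ => continuous_const⟩

theorem ContFam.comp {β : Type*} [TopologicalSpace β] {T : α → E → F} (hT : ContFam T)
    {g : β → α} (hg : Continuous g) : ContFam (fun x => T (g x)) :=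
  ⟨fun x => hT.1 (g x), fun l => (hT.2 l).comp hg⟩

theorem ContFam.dirDeriv {T : α → E → F} (hT : ContFam T) (e : E) :
    ContFam (fun x => pd e (T x)) :=
  ⟨fun x => (hT.1 x).dirDeriv e, fun l => hT.2 (e :: l)⟩

theorem ContFam.continuous_apply_zero {T : α → E → F} (hT : ContFam T) :
    Continuous fun x => T x 0 := hT.2 []

theorem ContFam.add {T T' : α → E → F} (hT : ContFam T) (hT' : ContFam T') :
    ContFam (fun x z => T x z + T' x z) :=
  ⟨fun x => (hT.1 x).add (hT'.1 x), fun l => by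
    simp only [dirs_add l (hT.1 _) (hT'.1 _)]
    exact (hT.2 l).add (hT'.2 l)⟩

theorem ContFam.clm {T : α → E → F} (hT : ContFam T) (A : F →L[ℝ] G) :
    ContFam (fun x z => A (T x z)) :=
  ⟨fun x => by filter_upwards [hT.1 x] with z hz using A.contDiff.contDiffAt.comp z hz,
    fun l => by
      simp only [dirs_clm_comp A l (hT.1 _)]
      exact A.continuous.comp (hT.2 l)⟩

theorem ContFam.mul {T T' : α → E → ℝ} (hT : ContFam T) (hT' : ContFam T') :
    ContFam (fun x z => T x z * T' x z) := by
  refine ⟨fun x => (hT.1 x).mul (hT'.1 x), fun l => ?_⟩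
  induction l generalizing T T' with
  | nil => exact (hT.2 []).mul (hT'.2 [])
  | cons e l ih =>
    have h : ∀ x, dirs (e :: l) (fun z => T x z * T' x z) 0 =
        dirs l (fun z => pd e (T x) z * T' x z) 0 + dirs l (fun z => T x z * pd e (T' x) z) 0 := by
      intro x
      have h : pd e (fun z => T x z * T' x z) =ᶠ[𝓝 0]
          fun z => pd e (T x) z * T' x z + T x z * pd e (T' x) z := by
        filter_upwards [(hT.1 x).eventually_differentiableAt,
          (hT'.1 x).eventually_differentiableAt] with z h1 h2 using pd_mul e h1 h2
      exact (dirs_eq_of_eventuallyEq l h).trans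
        (dirs_add l (((hT.1 x).dirDeriv e).mul (hT'.1 x)) ((hT.1 x).mul ((hT'.1 x).dirDeriv e)))
    simp only [h]
    exact (ih (hT.dirDeriv e) hT').add (ih hT (hT'.dirDeriv e))

theorem ContFam.const_mul {T : α → E → ℝ} (hT : ContFam T) (c : ℝ) :
    ContFam (fun x z => c * T x z) :=
  (contFam_const (smoothNear_const c)).mul hT

theorem ContFam.sub {T T' : α → E → ℝ} (hT : ContFam T) (hT' : ContFam T') :
    ContFam (fun x z => T x z - T' x z) := by
  refine (hT.add (hT'.const_mul (-1))).congr fun x => Eventually.of_forall fun z => ?_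
  ring

theorem ContFam.coord {ι : Type*} [Fintype ι] {T : α → E → ι → ℝ} (hT : ContFam T) (i : ι) :
    ContFam (fun x z => T x z i) :=
  hT.clm (ContinuousLinearMap.proj (R := ℝ) (φ := fun _ : ι => ℝ) i)

theorem SmoothGerm.continuous_iteratedFDeriv (k : ℕ) :
    Continuous fun f : SmoothGerm E F => iteratedFDeriv ℝ k f.toFun 0 :=
  continuous_iInf_dom (i := k) continuous_induced_dom

/-- Directional derivatives at the origin are evaluations of jets, and the jet maps are continuous
by definition of the topology. With the closure of `ContFam` under derivatives, sums and products,
this makes every derivative of `Hbar` at the origin continuous in the germ. -/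
theorem SmoothGerm.contFam : ContFam (fun f : SmoothGerm E F => f.toFun) := by
  refine ⟨fun f => f.smooth, fun l => ?_⟩
  obtain ⟨m, hm⟩ := exists_dirs_eq_iteratedFDeriv (F := F) l
  have h : ∀ f : SmoothGerm E F, dirs l f.toFun 0 = iteratedFDeriv ℝ l.length f.toFun 0 m :=
    fun f => hm _ f.smooth.self
  simp only [h]
  exact (ContinuousMultilinearMap.apply ℝ (fun _ : Fin l.length => E) F m).continuous.comp
    (SmoothGerm.continuous_iteratedFDeriv l.length)

/-- Affine paths of germs are continuous. -/
theorem SmoothGerm.continuous_of_affine {f g : E → F} (hf : SmoothNear f) (hg : SmoothNear g)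
    (c : ℝ → SmoothGerm E F) (hc : ∀ t z, (c t).toFun z = f z + t • g z) : Continuous c := by
  refine continuous_iInf_rng.2 fun k => continuous_induced_rng.2 ?_
  have h : ∀ t, iteratedFDeriv ℝ k (c t).toFun 0 =
      iteratedFDeriv ℝ k f 0 + t • iteratedFDeriv ℝ k g 0 := by
    intro t
    have hk : ∀ {u : E → F}, SmoothNear u → ContDiffAt ℝ k u 0 :=
      fun hu => hu.self.of_le (by exact_mod_cast le_top)
    have e : (c t).toFun = f + t • g := funext fun z => hc t z
    have ht : ContDiffAt ℝ k (t • g) 0 := (hk hg).const_smul t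
    rw [e, iteratedFDeriv_add_apply (hk hf) ht,
      iteratedFDeriv_const_smul_apply (hk hg)]
  change Continuous fun t => iteratedFDeriv ℝ k (c t).toFun 0
  simp only [h]
  fun_prop

end ContinuousFamilies

/-! ### Polynomial identities for the mean curvature expression -/

section Algebra

/-- The polynomial expression of `H̄` in the first and second derivatives of a parametrization. -/
def HbarPoly (a b c d f : Space) : ℝ :=
  mink (mcross a b) c * mink b b - 2 * mink (mcross a b) d * mink a b +
    mink (mcross a b) f * mink a a

theorem mink_add_left (a b c : Space) : mink (a + b) c = mink a c + mink b c := by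
  simp only [mink, Pi.add_apply]; ring

theorem mink_add_right (a b c : Space) : mink a (b + c) = mink a b + mink a c := by
  simp only [mink, Pi.add_apply]; ring

theorem mink_smul_left (t : ℝ) (a b : Space) : mink (t • a) b = t * mink a b := by
  simp only [mink, Pi.smul_apply, smul_eq_mul]; ring

theorem mink_smul_right (t : ℝ) (a b : Space) : mink a (t • b) = t * mink a b := by
  simp only [mink, Pi.smul_apply, smul_eq_mul]; ring

theorem mink_comm (a b : Space) : mink a b = mink b a := by
  simp only [mink]; ring

theorem mink_mcross_self_left (a b : Space) : mink (mcross a b) a = 0 := by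
  simp [mink, mcross]; ring

theorem mink_mcross_self_right (a b : Space) : mink (mcross a b) b = 0 := by
  simp [mink, mcross]; ring

theorem mcross_combination (a b : Space) (p₁ p₂ q₁ q₂ : ℝ) :
    mcross (p₁ • a + p₂ • b) (q₁ • a + q₂ • b) = (p₁ * q₂ - p₂ * q₁) • mcross a b := by
  ext i
  fin_cases i <;> simp [mcross] <;> ring

theorem mcross_perturb (a b w : Space) (α β : ℝ) :
    mcross (a + α • w) (b + β • w) = mcross a b + α • mcross w b + β • mcross a w := by
  ext i
  fin_cases i <;> simp [mcross] <;> ring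

/-- The vector product is multiplied by the Jacobian and annihilates the tangential parts of the
second derivatives. The expression lG - 2mF + nE is the polarized determinant of the two quadratic
forms, hence is multiplied by the squared Jacobian; altogether weight 3. -/
theorem HbarPoly_change_of_coordinates (a b c d f : Space) (p₁ p₂ q₁ q₂ r₁ r₂ s₁ s₂ t₁ t₂ : ℝ) :
    HbarPoly (p₁ • a + p₂ • b) (q₁ • a + q₂ • b)
      (r₁ • a + r₂ • b + (p₁ * p₁) • c + (2 * p₁ * p₂) • d + (p₂ * p₂) • f)
      (s₁ • a + s₂ • b + (p₁ * q₁) • c + (p₁ * q₂ + p₂ * q₁) • d + (p₂ * q₂) • f)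
      (t₁ • a + t₂ • b + (q₁ * q₁) • c + (2 * q₁ * q₂) • d + (q₂ * q₂) • f) =
    (p₁ * q₂ - p₂ * q₁) ^ 3 * HbarPoly a b c d f := by
  simp only [HbarPoly, mcross_combination, mink_add_left, mink_add_right, mink_smul_left,
    mink_smul_right, mink_mcross_self_left, mink_mcross_self_right, mink_comm b a]
  ring

/-- The change of the vector product is orthogonal to w, since det(w, b, w) = det(a, w, w) = 0. So
the second-order increments always meet the unperturbed ⟨a × b, w⟩, and every term beyond the
linearized operator carries a factor α or β. -/
theorem HbarPoly_perturb (a b c d f w : Space) (α β γ δ φ : ℝ) :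
    HbarPoly (a + α • w) (b + β • w) (c + γ • w) (d + δ • w) (f + φ • w) =
      HbarPoly a b c d f +
      mink (mcross a b) w * (γ * mink b b - 2 * δ * mink a b + φ * mink a a) +
      α * (mink (mcross w b) c * mink (b + β • w) (b + β • w)
        - 2 * (mink (mcross a b) d + δ * mink (mcross a b) w) * mink w (b + β • w)
        - 2 * mink (mcross w b) d * mink (a + α • w) (b + β • w)
        + (mink (mcross a b) f + φ * mink (mcross a b) w) * mink w (a + (a + α • w))
        + mink (mcross w b) f * mink (a + α • w) (a + α • w)) +
      β * (mink (mcross a w) c * mink (b + β • w) (b + β • w)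
        + (mink (mcross a b) c + γ * mink (mcross a b) w) * mink w (b + (b + β • w))
        - 2 * (mink (mcross a b) d + δ * mink (mcross a b) w) * mink w a
        - 2 * mink (mcross a w) d * mink (a + α • w) (b + β • w)
        + mink (mcross a w) f * mink (a + α • w) (a + α • w)) := by
  simp only [HbarPoly, mcross_perturb, mink_add_left, mink_add_right, mink_smul_left,
    mink_smul_right, mink_mcross_self_left, mink_mcross_self_right, mink_comm w a, mink_comm w b]
  ring

/-- The number is det(a, b, w). If it vanished, a linear relation between the rows would contradict
either the independence of a and b or the transversality of w. -/
theorem mink_mcross_ne_zero {a b w : Space} (hab : ∀ s t : ℝ, s • a + t • b = 0 → s = 0 ∧ t = 0)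
    (hw : ∀ s t : ℝ, s • a + t • b ≠ w) : mink (mcross a b) w ≠ 0 := by
  intro h
  rw [mink_mcross] at h
  obtain ⟨v, hv, hv0⟩ := Matrix.exists_vecMul_eq_zero_iff.2 h
  have hsum : v 0 • a + v 1 • b + v 2 • w = 0 := by
    ext j
    have := congrFun hv0 j
    simpa [Matrix.vecMul, dotProduct, Fin.sum_univ_three] using this
  by_cases h2 : v 2 = 0
  · rw [h2, zero_smul, add_zero] at hsum
    obtain ⟨h0, h1⟩ := hab _ _ hsum
    apply hv
    ext i
    fin_cases i <;> assumption
  · apply hw (-(v 2)⁻¹ * v 0) (-(v 2)⁻¹ * v 1)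
    have h3 : w = (v 2)⁻¹ • (v 2 • w) := by rw [smul_smul, inv_mul_cancel₀ h2, one_smul]
    have h4 : v 2 • w = -(v 0 • a + v 1 • b) := by
      rw [eq_neg_iff_add_eq_zero, add_comm]
      exact hsum
    rw [h3, h4]
    module

end Algebra

/-! ### The function H̄ under displacements, reparametrization and in families -/

section Analysis

variable {E : Type*} [NormedAddCommGroup E] [NormedSpace ℝ E]

/-- `H̄` of the restriction of a map `X` to the planes spanned by `e₁` and `e₂`. -/
noncomputable def HbarAlong (e₁ e₂ : E) (X : E → Space) (z : E) : ℝ :=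
  HbarPoly (pd e₁ X z) (pd e₂ X z) (pd e₁ (pd e₁ X) z) (pd e₂ (pd e₁ X) z) (pd e₂ (pd e₂ X) z)

theorem Hbar_eq_HbarAlong (x : Plane → Space) : Hbar x = HbarAlong (1, 0) (0, 1) x := rfl

section Families

variable {α : Type*} [TopologicalSpace α]

theorem ContFam.mink {S T : α → E → Space} (hS : ContFam S) (hT : ContFam T) :
    ContFam (fun x z => mink (S x z) (T x z)) := by
  simp only [Minkowski.mink]
  exact (((hS.coord 0).mul (hT.coord 0)).add ((hS.coord 1).mul (hT.coord 1))).sub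
    ((hS.coord 2).mul (hT.coord 2))

theorem ContFam.mink_mcross {R S T : α → E → Space} (hR : ContFam R) (hS : ContFam S)
    (hT : ContFam T) : ContFam (fun x z => Minkowski.mink (mcross (R x z) (S x z)) (T x z)) := by
  have h := fun (i j : Fin 3) => ((hR.coord i).mul (hS.coord j)).sub ((hR.coord j).mul (hS.coord i))
  refine ((((h 1 2).mul (hT.coord 0)).add ((h 2 0).mul (hT.coord 1))).sub
    ((h 1 0).mul (hT.coord 2))).congr fun x => Eventually.of_forall fun z => ?_
  simp [Minkowski.mink, mcross]

theorem ContFam.HbarAlong {X : α → E → Space} (hX : ContFam X) (e₁ e₂ : E) :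
    ContFam (fun x => HbarAlong e₁ e₂ (X x)) := by
  have h := hX.dirDeriv
  have hh := fun e e' => (h e).dirDeriv e'
  exact ((((h e₁).mink_mcross (h e₂) (hh e₁ e₁)).mul ((h e₂).mink (h e₂))).sub
    ((((h e₁).mink_mcross (h e₂) (hh e₁ e₂)).const_mul 2).mul ((h e₁).mink (h e₂)))).add
    (((h e₁).mink_mcross (h e₂) (hh e₂ e₂)).mul ((h e₁).mink (h e₁)))

end Families

theorem SmoothNear.mink {a b : E → Space} (ha : SmoothNear a) (hb : SmoothNear b) :
    SmoothNear (fun z => mink (a z) (b z)) :=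
  ((contFam_const (α := Unit) ha).mink (contFam_const hb)).1 ()

theorem SmoothNear.mink_mcross {a b c : E → Space} (ha : SmoothNear a) (hb : SmoothNear b)
    (hc : SmoothNear c) : SmoothNear (fun z => Minkowski.mink (mcross (a z) (b z)) (c z)) :=
  ((contFam_const (α := Unit) ha).mink_mcross (contFam_const hb) (contFam_const hc)).1 ()

theorem SmoothNear.HbarAlong {X : E → Space} (hX : SmoothNear X) (e₁ e₂ : E) :
    SmoothNear (HbarAlong e₁ e₂ X) :=
  ((contFam_const (α := Unit) hX).HbarAlong e₁ e₂).1 ()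

theorem SmoothNear.Hbar {x : Plane → Space} (hx : SmoothNear x) : SmoothNear (Hbar x) :=
  hx.HbarAlong _ _

theorem HbarAlong_eventuallyEq {X Y : E → Space} {z : E} (e₁ e₂ : E) (h : X =ᶠ[𝓝 z] Y) :
    HbarAlong e₁ e₂ X z = HbarAlong e₁ e₂ Y z := by
  simp only [HbarAlong, pd_eq_of_eventuallyEq _ h,
    pd_eq_of_eventuallyEq _ (pd_eventuallyEq _ h)]

/-- The effect on `H̄` of a displacement in a constant direction: the linearized operator, up to terms
that are divisible by the first derivatives of the displacement. -/
theorem exists_HbarAlong_add_smul {X : E → Space} (hX : SmoothNear X) {g : E → ℝ}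
    (hg : SmoothNear g) (w : Space) (e₁ e₂ : E) :
    ∃ R₁ R₂ : E → ℝ, SmoothNear R₁ ∧ SmoothNear R₂ ∧ ∀ᶠ z in 𝓝 0,
      HbarAlong e₁ e₂ (fun z => X z + g z • w) z = HbarAlong e₁ e₂ X z +
        mink (mcross (pd e₁ X z) (pd e₂ X z)) w *
          (pd e₁ (pd e₁ g) z * mink (pd e₂ X z) (pd e₂ X z) -
            2 * pd e₂ (pd e₁ g) z * mink (pd e₁ X z) (pd e₂ X z) +
            pd e₂ (pd e₂ g) z * mink (pd e₁ X z) (pd e₁ X z)) +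
        pd e₁ g z * R₁ z + pd e₂ g z * R₂ z := by
  have hd : ∀ {Y : E → Space} {k : E → ℝ}, SmoothNear Y → SmoothNear k → ∀ e : E,
      ∀ᶠ z in 𝓝 0, pd e (fun z => Y z + k z • w) z = pd e Y z + pd e k z • w := by
    intro Y k hY hk e
    filter_upwards [hY.eventually_differentiableAt, hk.eventually_differentiableAt] with z h1 h2
    rw [pd_add e h1 (h2.smul_const w)]
    congr 1
    exact pd_clm_comp ((ContinuousLinearMap.id ℝ ℝ).smulRight w) e h2
  have hdd : ∀ e e' : E, ∀ᶠ z in 𝓝 0, pd e' (pd e (fun z => X z + g z • w)) z =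
      pd e' (pd e X) z + pd e' (pd e g) z • w := by
    intro e e'
    filter_upwards [EventuallyEq.eventuallyEq_nhds (hd hX hg e),
      hd (hX.dirDeriv e) (hg.dirDeriv e) e'] with z h1 h2
    rw [pd_eq_of_eventuallyEq e' h1, h2]
  have k2 : SmoothNear (fun _ : E => (2 : ℝ)) := smoothNear_const 2
  have hw : SmoothNear (fun _ : E => w) := smoothNear_const w
  have a := hX.dirDeriv e₁
  have b := hX.dirDeriv e₂
  have c := a.dirDeriv e₁
  have d := a.dirDeriv e₂
  have f := b.dirDeriv e₂
  have a' := a.add ((hg.dirDeriv e₁).smul hw)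
  have b' := b.add ((hg.dirDeriv e₂).smul hw)
  have T := a.mink_mcross b hw
  have γ := (hg.dirDeriv e₁).dirDeriv e₁
  have δ := (hg.dirDeriv e₁).dirDeriv e₂
  have φ := (hg.dirDeriv e₂).dirDeriv e₂
  -- The remainders are the coefficients of α and β in `HbarPoly_perturb`; they are identified by
  -- unification with these smoothness proofs.
  refine ⟨_, _,
    (((((hw.mink_mcross b c).mul (b'.mink b')).sub
      ((k2.mul ((a.mink_mcross b d).add (δ.mul T))).mul (hw.mink b'))).sub
      ((k2.mul (hw.mink_mcross b d)).mul (a'.mink b'))).add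
      (((a.mink_mcross b f).add (φ.mul T)).mul (hw.mink (a.add a')))).add
      ((hw.mink_mcross b f).mul (a'.mink a')),
    (((((a.mink_mcross hw c).mul (b'.mink b')).add
      (((a.mink_mcross b c).add (γ.mul T)).mul (hw.mink (b.add b')))).sub
      ((k2.mul ((a.mink_mcross b d).add (δ.mul T))).mul (hw.mink a))).sub
      ((k2.mul (a.mink_mcross hw d)).mul (a'.mink b'))).add
      ((a.mink_mcross hw f).mul (a'.mink a')), ?_⟩
  filter_upwards [hd hX hg e₁, hd hX hg e₂, hdd e₁ e₁, hdd e₁ e₂, hdd e₂ e₂] with z h1 h2 h3 h4 h5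
  rw [HbarAlong, h1, h2, h3, h4, h5, HbarPoly_perturb, HbarAlong]

theorem delta_comp {x : Plane → Space} {φ : Plane → Plane} (hx : SmoothNear x) (hφ : SmoothNear φ)
    (hφ0 : φ 0 = 0) : delta (fun q => x (φ q)) 0 =
      ((pd (1, 0) φ 0).1 * (pd (0, 1) φ 0).2 - (pd (1, 0) φ 0).2 * (pd (0, 1) φ 0).1) ^ 2 *
        delta x 0 := by
  have h : ∀ e, pd e (fun q => x (φ q)) 0 =
      (pd e φ 0).1 • pd (1, 0) x 0 + (pd e φ 0).2 • pd (0, 1) x 0 := by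
    intro e
    rw [pd_comp e (by rw [hφ0]; exact hx.differentiableAt) hφ.differentiableAt, pd_plane x, hφ0]
  change mink (pd (1, 0) _ 0) (pd (0, 1) _ 0) ^ 2 -
    mink (pd (1, 0) _ 0) (pd (1, 0) _ 0) * mink (pd (0, 1) _ 0) (pd (0, 1) _ 0) = _ * (
    mink (pd (1, 0) x 0) (pd (0, 1) x 0) ^ 2 -
    mink (pd (1, 0) x 0) (pd (1, 0) x 0) * mink (pd (0, 1) x 0) (pd (0, 1) x 0))
  simp only [h, mink_add_left, mink_add_right, mink_smul_left, mink_smul_right,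
    mink_comm (pd (0, 1) x 0) (pd (1, 0) x 0)]
  ring

theorem pd_smul {F : Type*} [NormedAddCommGroup F] [NormedSpace ℝ F] {f : E → ℝ} {g : E → F} {z : E}
    (e : E) (hf : DifferentiableAt ℝ f z) (hg : DifferentiableAt ℝ g z) :
    pd e (fun z => f z • g z) z = pd e f z • g z + f z • pd e g z := by
  simp only [pd, fderiv_fun_smul hf hg]
  simp [add_comm]

/-- `H̄` is a relative invariant of weight 3 under changes of coordinates. -/
theorem Hbar_comp {x : Plane → Space} {φ : Plane → Plane} (hx : SmoothNear x) (hφ : SmoothNear φ)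
    (hφ0 : φ 0 = 0) : ∀ᶠ q in 𝓝 (0 : Plane), Hbar (fun q => x (φ q)) q =
      ((pd (1, 0) φ q).1 * (pd (0, 1) φ q).2 - (pd (1, 0) φ q).2 * (pd (0, 1) φ q).1) ^ 3 *
        Hbar x (φ q) := by
  have ht := hφ.tendsto hφ0
  have h1 : ∀ {g : Plane → Space}, SmoothNear g → ∀ e, ∀ᶠ q in 𝓝 (0 : Plane),
      pd e (fun q => g (φ q)) q =
        (pd e φ q).1 • pd (1, 0) g (φ q) + (pd e φ q).2 • pd (0, 1) g (φ q) := by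
    intro g hg e
    filter_upwards [ht.eventually hg.eventually_differentiableAt, hφ.eventually_differentiableAt]
      with q d1 d2
    rw [pd_comp e d1 d2, pd_plane g]
  have hu := hx.dirDeriv (1, 0)
  have hv := hx.dirDeriv (0, 1)
  have h2 : ∀ e e', ∀ᶠ q in 𝓝 (0 : Plane), pd e' (pd e (fun q => x (φ q))) q =
      (pd e' (fun q => (pd e φ q).1) q) • pd (1, 0) x (φ q) +
      (pd e' (fun q => (pd e φ q).2) q) • pd (0, 1) x (φ q) +
      ((pd e φ q).1 * (pd e' φ q).1) • pd (1, 0) (pd (1, 0) x) (φ q) +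
      ((pd e φ q).1 * (pd e' φ q).2 + (pd e φ q).2 * (pd e' φ q).1) •
        pd (0, 1) (pd (1, 0) x) (φ q) +
      ((pd e φ q).2 * (pd e' φ q).2) • pd (0, 1) (pd (0, 1) x) (φ q) := by
    intro e e'
    have f1 := (hφ.dirDeriv e).fst
    have f2 := (hφ.dirDeriv e).snd
    have f3 := hu.comp hφ hφ0
    have f4 := hv.comp hφ hφ0
    filter_upwards [EventuallyEq.eventuallyEq_nhds (h1 hx e), f1.eventually_differentiableAt,
      f2.eventually_differentiableAt, f3.eventually_differentiableAt,
      f4.eventually_differentiableAt, h1 hu e', h1 hv e', ht.eventually hx]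
      with q a1 a2 a3 a4 a5 a6 a7 a8
    rw [pd_eq_of_eventuallyEq e' a1, pd_add e' (a2.fun_smul a4) (a3.fun_smul a5), pd_smul e' a2 a4,
      pd_smul e' a3 a5, a6, a7, pd_pd_comm a8 (1, 0) (0, 1)]
    module
  filter_upwards [h1 hx (1, 0), h1 hx (0, 1), h2 (1, 0) (1, 0), h2 (1, 0) (0, 1),
    h2 (0, 1) (0, 1)] with q a1 a2 a3 a4 a5
  rw [Hbar_eq_HbarAlong, Hbar_eq_HbarAlong, HbarAlong, a1, a2, a3, a4, a5, HbarAlong,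
    ← HbarPoly_change_of_coordinates]
  congr 3 <;> ring_nf

/-- `H̄` of a family of parametrizations, as a differential expression in all the variables. -/
theorem HbarFamily_eventuallyEq {X : Plane × ℝ → Space} (hX : SmoothNear X) :
    HbarFamily X =ᶠ[𝓝 0] HbarAlong ((1, 0), 0) ((0, 1), 0) X := by
  have hsl : ∀ {Y : Plane × ℝ → Space} {z : Plane × ℝ} (e : Plane),
      (DifferentiableAt ℝ Y z) → pd e (fun q => Y (q, z.2)) z.1 = pd (e, 0) Y z := by
    intro Y z e hY
    have hd : HasFDerivAt (fun q : Plane => ((q, z.2) : Plane × ℝ))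
        (ContinuousLinearMap.inl ℝ Plane ℝ) z.1 :=
      hasFDerivAt_prodMk_left z.1 z.2
    rw [pd_comp (g := fun q : Plane => ((q, z.2) : Plane × ℝ)) e hY hd.differentiableAt]
    congr 1
    rw [pd, hd.fderiv]
    rfl
  have hev : ∀ᶠ z in 𝓝 (0 : Plane × ℝ), ∀ᶠ w in 𝓝 z, ContDiffAt ℝ ∞ X w :=
    eventually_eventually_nhds.2 hX
  filter_upwards [hev] with z hz
  have hz0 := hz.self_of_nhds
  have hc : Tendsto (fun q : Plane => ((q, z.2) : Plane × ℝ)) (𝓝 z.1) (𝓝 z) :=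
    (continuous_id.prodMk continuous_const).tendsto' _ _ rfl
  have h1 : ∀ e : Plane, pd e (fun q => X (q, z.2)) =ᶠ[𝓝 z.1] fun q => pd (e, 0) X (q, z.2) := by
    intro e
    filter_upwards [hc.eventually hz] with q hq
    exact hsl (z := (q, z.2)) e (hq.differentiableAt (by simp))
  have h2 : ∀ e e' : Plane, pd e' (pd e (fun q => X (q, z.2))) z.1 = pd (e', 0) (pd (e, 0) X) z := by
    intro e e'
    rw [pd_eq_of_eventuallyEq e' (h1 e)]
    refine hsl (Y := pd (e, 0) X) e' ?_
    exact ((hz0.fderiv_right (m := ∞) (by simp)).clm_apply contDiffAt_const).differentiableAt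
      (by simp)
  rw [HbarFamily, Hbar_eq_HbarAlong, HbarAlong, HbarAlong, h2, h2, h2, (h1 _).self_of_nhds,
    (h1 _).self_of_nhds]

end Analysis

/-! ### Invariance of nondegeneracy and of the Lorentzian condition -/

section ChangeOfCoordinates

theorem delta_eq_of_eventuallyEq {x y : Plane → Space} {q : Plane} (h : x =ᶠ[𝓝 q] y) :
    delta x q = delta y q := by
  simp only [delta, coeffE, coeffF, coeffG, du, dv, h.fderiv_eq]

theorem Hbar_eventuallyEq {x y : Plane → Space} {q : Plane} (h : x =ᶠ[𝓝 q] y) :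
    Hbar x =ᶠ[𝓝 q] Hbar y := by
  filter_upwards [h.eventuallyEq_nhds] with p hp using HbarAlong_eventuallyEq _ _ hp

/-- The effect of right-equivalence on the 2-jet of `H̄` at a singular point of the MCNC. -/
theorem REquiv.Hbar_singular {x y : Plane → Space} (h : REquiv x y) (hx : SmoothNear x)
    (h0 : Hbar x 0 = 0) (h1 : fderiv ℝ (Hbar x) 0 = 0) :
    Hbar y 0 = 0 ∧ fderiv ℝ (Hbar y) 0 = 0 ∧ ∃ J : ℝ, delta y 0 = J ^ 2 * delta x 0 ∧
      hessDet (Hbar y) = J ^ 8 * hessDet (Hbar x) := by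
  obtain ⟨φ, ⟨hφ, hφ0, -⟩, hy⟩ := h
  have hy' : y =ᶠ[𝓝 0] fun q => x (φ q) := hy
  have a := (hφ.dirDeriv (1, 0)).fst
  have b := (hφ.dirDeriv (0, 1)).snd
  have c := (hφ.dirDeriv (1, 0)).snd
  have d := (hφ.dirDeriv (0, 1)).fst
  -- The multiplier is the cubed Jacobian, which contributes J⁶; the substitution contributes J²,
  -- hence the exponent 8.
  obtain ⟨e0, e1, e2⟩ := hessDet_mul_comp hx.Hbar (((a.mul b).sub (c.mul d)).pow 3) hφ hφ0
    ((Hbar_eventuallyEq hy').trans (Hbar_comp hx hφ hφ0)) h0 h1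
  refine ⟨e0, e1, (pd (1, 0) φ 0).1 * (pd (0, 1) φ 0).2 - (pd (1, 0) φ 0).2 * (pd (0, 1) φ 0).1,
    ?_, ?_⟩
  · rw [delta_eq_of_eventuallyEq hy', delta_comp hx hφ hφ0]
  · rw [e2]
    ring

/-- The inverse equivalence writes δ of x as J² times δ of y; positivity of the product then
suffices, without knowing that J is nonzero. -/
theorem REquiv.delta_pos {x y : Plane → Space} (h : REquiv x y) (hx : SmoothNear x)
    (hy : SmoothNear y) (h0 : Hbar x 0 = 0) (h1 : fderiv ℝ (Hbar x) 0 = 0) (hd : 0 < delta x 0) :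
    0 < delta y 0 := by
  obtain ⟨e0, e1, -⟩ := h.Hbar_singular hx h0 h1
  obtain ⟨-, -, J, hJ, -⟩ := h.symm.Hbar_singular hy e0 e1
  rw [hJ] at hd
  exact pos_of_mul_pos_right hd (sq_nonneg J)

end ChangeOfCoordinates

/-! ### Transverse directions -/

section Transversality

theorem LocalParam.mink_mcross_ne_zero (x : LocalParam) {w : Space}
    (hw : w ∉ Set.range (fderiv ℝ x.toFun 0)) :
    mink (mcross (pd (1, 0) x.toFun 0) (pd (0, 1) x.toFun 0)) w ≠ 0 := by
  refine Minkowski.mink_mcross_ne_zero (fun s t h => ?_) fun s t h => hw ⟨(s, t), ?_⟩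
  · have h' : fderiv ℝ x.toFun 0 (s, t) = fderiv ℝ x.toFun 0 0 :=
      (pd_plane x.toFun (s, t) 0).trans (h.trans (map_zero _).symm)
    exact Prod.mk.inj (x.immersion h')
  · exact (pd_plane x.toFun (s, t) 0).trans h

theorem LocalParam.exists_notMem_range (x : LocalParam) :
    ∃ w : Space, w ∉ Set.range (fderiv ℝ x.toFun 0) := by
  by_contra! h
  have hs : Function.Surjective (fderiv ℝ x.toFun 0 : Plane →ₗ[ℝ] Space) := fun w => h w
  have := LinearMap.finrank_le_finrank_of_surjective hs
  simp at this

end Transversality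

/-! ### Density along paths -/

section Density

/-- Each point of S is the limit, as t tends to 0 through nonzero values, of points of a path inside
S that have the property. -/
theorem dense_of_paths {X : Type*} [TopologicalSpace X] {S : Set X} {P : X → Prop}
    (h : ∀ g ∈ S, ∃ c : ℝ → X, Continuous c ∧ c 0 = g ∧ (∀ t, c t ∈ S) ∧
      ∀ᶠ t in 𝓝[≠] (0 : ℝ), P (c t)) : Dense {g : S | P g} := by
  rintro ⟨g, hg⟩
  obtain ⟨c, hc, hc0, hcS, hcP⟩ := h g hg
  have ht : Tendsto (fun t => (⟨c t, hcS t⟩ : S)) (𝓝[≠] 0) (𝓝 ⟨g, hg⟩) := by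
    rw [tendsto_subtype_rng]
    exact (hc.tendsto' 0 g hc0).mono_left nhdsWithin_le_nhds
  exact mem_closure_of_tendsto ht hcP

theorem eventually_quadratic_ne_zero (a b : ℝ) {c : ℝ} (hc : c ≠ 0) :
    ∀ᶠ t in 𝓝[≠] (0 : ℝ), a + b * t + c * t ^ 2 ≠ 0 := by
  have hne : ∀ᶠ t in 𝓝[≠] (0 : ℝ), t ≠ 0 := self_mem_nhdsWithin
  by_cases ha : a = 0
  · by_cases hb : b = 0
    · filter_upwards [hne] with t ht
      simpa [ha, hb] using ⟨hc, ht⟩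
    · have h : ∀ᶠ t in 𝓝 (0 : ℝ), b + c * t ≠ 0 := by
        have hcont : ContinuousAt (fun t : ℝ => b + c * t) 0 := by fun_prop
        exact hcont.eventually_ne (by simpa using hb)
      filter_upwards [hne, h.filter_mono nhdsWithin_le_nhds] with t ht h
      have : a + b * t + c * t ^ 2 = t * (b + c * t) := by rw [ha]; ring
      rw [this]
      exact mul_ne_zero ht h
  · have hcont : ContinuousAt (fun t : ℝ => a + b * t + c * t ^ 2) 0 := by fun_prop
    exact (hcont.eventually_ne (by simpa using ha)).filter_mono nhdsWithin_le_nhds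

theorem eventually_linear_ne_zero (a : ℝ) {d : ℝ} (hd : d ≠ 0) :
    ∀ᶠ t in 𝓝[≠] (0 : ℝ), a + d * t ≠ 0 := by
  by_cases ha : a = 0
  · filter_upwards [self_mem_nhdsWithin] with t ht
    simpa [ha] using ⟨hd, ht⟩
  · have hcont : ContinuousAt (fun t : ℝ => a + d * t) 0 := by fun_prop
    exact (hcont.eventually_ne (by simpa using ha)).filter_mono nhdsWithin_le_nhds

end Density

/-! ### Generic 1-parameter families -/

section Families

theorem isDeformation_HbarFamily {x : Plane → Space} {X : Plane × ℝ → Space} (hX : SmoothNear X)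
    (hXx : ∀ᶠ q in 𝓝 (0 : Plane), X (q, 0) = x q) : IsDeformation (Hbar x) (HbarFamily X) := by
  have hXx' : (fun q => X (q, 0)) =ᶠ[𝓝 0] x := hXx
  refine ⟨(hX.HbarAlong _ _).congr (HbarFamily_eventuallyEq hX).symm, ?_⟩
  filter_upwards [Hbar_eventuallyEq hXx'] with q hq using hq

/-- Puts the velocity criterion in terms of one differential expression in all the variables of X,
so that both its continuity in X and its change under a displacement are accessible. -/
theorem isRVersal_HbarFamily_iff {x : Plane → Space} {X : Plane × ℝ → Space} (hX : SmoothNear X)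
    (hXx : ∀ᶠ q in 𝓝 (0 : Plane), X (q, 0) = x q) (h1 : fderiv ℝ (Hbar x) 0 = 0)
    (hdet : hessDet (Hbar x) ≠ 0) :
    IsRVersal (Hbar x) (HbarFamily X) ↔
      pd (0, 1) (HbarAlong ((1, 0), 0) ((0, 1), 0) X) 0 ≠ 0 := by
  rw [isRVersal_iff_of_hessDet_ne_zero (isDeformation_HbarFamily hX hXx) h1 hdet,
    pd_eq_of_eventuallyEq _ (HbarFamily_eventuallyEq hX)]
/-- A displacement in a transverse direction that changes the velocity of `H̄` at the origin. -/
theorem exists_family_perturbation {x : LocalParam} {X : Plane × ℝ → Space} (hX : SmoothNear X)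
    (hXx : ∀ᶠ q in 𝓝 (0 : Plane), X (q, 0) = x.toFun q) (hδ : 0 < delta x.toFun 0) {w : Space}
    (hw : w ∉ Set.range (fderiv ℝ x.toFun 0)) :
    ∃ (g : Plane × ℝ → ℝ) (d : ℝ), SmoothNear g ∧ (∀ q, g (q, 0) = 0) ∧ d ≠ 0 ∧ ∀ ε : ℝ,
      pd (0, 1) (HbarAlong ((1, 0), 0) ((0, 1), 0) (fun z => X z + (ε * g z) • w)) 0 =
        pd (0, 1) (HbarAlong ((1, 0), 0) ((0, 1), 0) X) 0 + d * ε := by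
  set e₁ : Plane × ℝ := ((1, 0), 0) with he₁
  set e₂ : Plane × ℝ := ((0, 1), 0) with he₂
  have s1 : pd e₁ X 0 = pd (1, 0) x.toFun 0 := (pd_slice hX hXx (1, 0)).self_of_nhds
  have s2 : pd e₂ X 0 = pd (0, 1) x.toFun 0 := (pd_slice hX hXx (0, 1)).self_of_nhds
  have hT := x.mink_mcross_ne_zero hw
  rw [← s1, ← s2] at hT
  set P := mink (pd e₂ X 0) (pd e₂ X 0) with hP
  set Q := mink (pd e₁ X 0) (pd e₂ X 0) with hQ
  set R := mink (pd e₁ X 0) (pd e₁ X 0) with hR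
  have hδ' : 0 < Q ^ 2 - R * P := by
    rw [hP, hQ, hR, s1, s2]
    exact hδ
  -- The Lorentzian condition excludes P = Q = R = 0.
  have hsum : P * P + Q * Q + R * R ≠ 0 := by nlinarith [sq_nonneg (P + R)]
  have hu := smoothNear_coord_fst (S := ℝ)
  have hv := smoothNear_coord_snd (S := ℝ)
  have ht : SmoothNear (fun z : Plane × ℝ => z.2) := contDiff_snd.smoothNear
  have k := fun c : ℝ => smoothNear_const (E := Plane × ℝ) c
  have ptt : ∀ e z : Plane × ℝ, pd e (fun z : Plane × ℝ => z.2) z = e.2 :=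
    fun e z => pd_clm (ContinuousLinearMap.snd ℝ Plane ℝ) e z
  -- The factor t keeps the initial surface. The quadratic form in u, v is chosen so that P g_uu -
  -- 2Q g_uv + R g_vv is t times the positive number 2(P² + Q² + R²).
  refine ⟨fun z => z.2 * (P * (z.1.1 * z.1.1) + (-Q) * (z.1.1 * z.1.2) + R * (z.1.2 * z.1.2)),
    mink (mcross (pd e₁ X 0) (pd e₂ X 0)) w * (2 * (P * P + Q * Q + R * R)),
    ht.mul ((((k P).mul (hu.mul hu)).add ((k (-Q)).mul (hu.mul hv))).add ((k R).mul (hv.mul hv))),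
    by simp, mul_ne_zero hT (mul_ne_zero two_ne_zero hsum), fun ε => ?_⟩
  set g : Plane × ℝ → ℝ := fun z => ε * (z.2 *
    (P * (z.1.1 * z.1.1) + (-Q) * (z.1.1 * z.1.2) + R * (z.1.2 * z.1.2))) with hg
  have hgs : SmoothNear g := (k ε).mul (ht.mul
    ((((k P).mul (hu.mul hu)).add ((k (-Q)).mul (hu.mul hv))).add ((k R).mul (hv.mul hv))))
  have p1 : pd e₁ g = fun z => ε * (z.2 * (2 * P * z.1.1 + (-Q) * z.1.2)) := by
    ext z
    simp (disch := fun_prop) only [hg, pd_mul, pd_add, pd_const, pd_coord_fst, pd_coord_snd, ptt]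
    simp only [he₁]
    ring
  have p2 : pd e₂ g = fun z => ε * (z.2 * ((-Q) * z.1.1 + 2 * R * z.1.2)) := by
    ext z
    simp (disch := fun_prop) only [hg, pd_mul, pd_add, pd_const, pd_coord_fst, pd_coord_snd, ptt]
    simp only [he₂]
    ring
  have p11 : pd e₁ (pd e₁ g) = fun z => ε * (z.2 * (2 * P)) := by
    ext z
    simp (disch := fun_prop) only [p1, pd_mul, pd_add, pd_const, pd_coord_fst, pd_coord_snd, ptt]
    simp only [he₁]
    ring
  have p12 : pd e₂ (pd e₁ g) = fun z => ε * (z.2 * (-Q)) := by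
    ext z
    simp (disch := fun_prop) only [p1, pd_mul, pd_add, pd_const, pd_coord_fst, pd_coord_snd, ptt]
    simp only [he₂]
    ring
  have p22 : pd e₂ (pd e₂ g) = fun z => ε * (z.2 * (2 * R)) := by
    ext z
    simp (disch := fun_prop) only [p2, pd_mul, pd_add, pd_const, pd_coord_fst, pd_coord_snd, ptt]
    simp only [he₂]
    ring
  obtain ⟨R₁, R₂, hR₁, hR₂, hpert⟩ := exists_HbarAlong_add_smul hX hgs w e₁ e₂
  have a := hX.dirDeriv e₁
  have b := hX.dirDeriv e₂
  -- The increment of H̄ is exactly ε t W, so the velocity at the origin changes by ε W(0). The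
  -- remainders depend on ε, but they enter W multiplied by linear forms in u, v, so W(0) does not.
  let W : Plane × ℝ → ℝ := fun z => mink (mcross (pd e₁ X z) (pd e₂ X z)) w *
      (2 * P * mink (pd e₂ X z) (pd e₂ X z) - 2 * (-Q) * mink (pd e₁ X z) (pd e₂ X z) +
        2 * R * mink (pd e₁ X z) (pd e₁ X z)) +
      (2 * P * z.1.1 + (-Q) * z.1.2) * R₁ z + ((-Q) * z.1.1 + 2 * R * z.1.2) * R₂ z
  have hW : SmoothNear W :=
    (((a.mink_mcross b (smoothNear_const w)).mul
      ((((k _).mul (b.mink b)).sub ((k _).mul (a.mink b))).add ((k _).mul (a.mink a)))).add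
      ((((k _).mul hu).add ((k _).mul hv)).mul hR₁)).add
      ((((k _).mul hu).add ((k _).mul hv)).mul hR₂)
  have hev : HbarAlong e₁ e₂ (fun z => X z + g z • w) =ᶠ[𝓝 0]
      fun z => HbarAlong e₁ e₂ X z + z.2 * (ε * W z) := by
    filter_upwards [hpert] with z hz
    rw [hz, p11, p12, p22, p1, p2]
    simp only [W]
    ring
  have hWε := (k ε).mul hW
  rw [pd_eq_of_eventuallyEq _ hev, pd_add _ (hX.HbarAlong _ _).differentiableAt
    (ht.mul hWε).differentiableAt, pd_mul _ ht.differentiableAt hWε.differentiableAt, ptt]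
  have hW0 : W 0 = mink (mcross (pd e₁ X 0) (pd e₂ X 0)) w * (2 * (P * P + Q * Q + R * R)) := by
    simp only [W, ← hP, ← hQ, ← hR, Prod.fst_zero, Prod.snd_zero]
    ring
  rw [hW0]
  simp only [Prod.snd_zero]
  ring

theorem genericallyVersal_of_hessDet_ne_zero (x : LocalParam) (hδ : 0 < delta x.toFun 0)
    (h1 : fderiv ℝ (Hbar x.toFun) 0 = 0) (hdet : hessDet (Hbar x.toFun) ≠ 0) :
    GenericallyVersal x := by
  have hin : Tendsto (fun q : Plane => ((q, 0) : Plane × ℝ)) (𝓝 0) (𝓝 0) :=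
    (continuous_id.prodMk continuous_const).tendsto' _ _ rfl
  have hx1 : SmoothNear (fun z : Plane × ℝ => x.toFun z.1) :=
    x.smooth.comp contDiff_fst.smoothNear rfl
  refine ⟨⟨?_, ?_⟩, fun w hw => ⟨?_, ?_⟩⟩
  · have hset : {X : familiesOf x | IsRVersal (Hbar x.toFun) (HbarFamily X.1.toFun)} =
        {X : familiesOf x | pd (0, 1) (HbarAlong ((1, 0), 0) ((0, 1), 0) X.1.toFun) 0 ≠ 0} := by
      ext X
      exact isRVersal_HbarFamily_iff X.1.smooth X.2 h1 hdet
    rw [hset]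
    exact isOpen_ne.preimage
      (((SmoothGerm.contFam.HbarAlong ((1, 0), 0) ((0, 1), 0)).2 [(0, 1)]).comp
        continuous_subtype_val)
  · refine dense_of_paths (S := familiesOf x)
      (P := fun X => IsRVersal (Hbar x.toFun) (HbarFamily X.toFun)) fun X hX => ?_
    obtain ⟨w, hw⟩ := x.exists_notMem_range
    obtain ⟨g, d, hg, hg0, hd, hgd⟩ := exists_family_perturbation X.smooth hX hδ hw
    have hgw : SmoothNear (fun z => g z • w) := hg.smul (smoothNear_const w)
    have hs : ∀ t : ℝ, SmoothNear (fun z => X.toFun z + (t * g z) • w) := fun t =>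
      X.smooth.add (((smoothNear_const t).mul hg).smul (smoothNear_const w))
    have hmem : ∀ t : ℝ, ∀ᶠ q in 𝓝 (0 : Plane),
        X.toFun (q, 0) + (t * g (q, 0)) • w = x.toFun q := by
      intro t
      filter_upwards [hX] with q hq
      simp [hg0, hq]
    refine ⟨fun t => ⟨fun z => X.toFun z + (t * g z) • w, hs t⟩,
      SmoothGerm.continuous_of_affine X.smooth hgw _ fun t z => by simp only [mul_smul], ?_,
      hmem, ?_⟩
    · simp
    · filter_upwards [eventually_linear_ne_zero _ hd] with t ht
      rw [isRVersal_HbarFamily_iff (hs t) (hmem t) h1 hdet, hgd]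
      exact ht
  · have hfam : ContFam (fun h : SmoothGerm (Plane × ℝ) ℝ => fun z => x.toFun z.1 + h.toFun z • w) :=
      (contFam_const hx1).add
        (SmoothGerm.contFam.clm ((ContinuousLinearMap.id ℝ ℝ).smulRight w))
    have hset : {h : heightPerturbations | IsRVersal (Hbar x.toFun)
          (HbarFamily fun z => x.toFun z.1 + h.1.toFun z • w)} =
        {h : heightPerturbations | pd (0, 1) (HbarAlong ((1, 0), 0) ((0, 1), 0)
          (fun z => x.toFun z.1 + h.1.toFun z • w)) 0 ≠ 0} := by
      ext h
      refine isRVersal_HbarFamily_iff (hfam.1 h.1) ?_ h1 hdet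
      filter_upwards [h.2] with q hq
      simp [hq]
    rw [hset]
    exact isOpen_ne.preimage
      (((hfam.HbarAlong ((1, 0), 0) ((0, 1), 0)).2 [(0, 1)]).comp continuous_subtype_val)
  · refine dense_of_paths (S := heightPerturbations) (P := fun h => IsRVersal (Hbar x.toFun)
      (HbarFamily fun z => x.toFun z.1 + h.toFun z • w)) fun h hh => ?_
    have hX : SmoothNear (fun z : Plane × ℝ => x.toFun z.1 + h.toFun z • w) :=
      hx1.add (h.smooth.smul (smoothNear_const w))
    have hXx : ∀ᶠ q in 𝓝 (0 : Plane), x.toFun q + h.toFun (q, 0) • w = x.toFun q := by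
      filter_upwards [hh] with q hq
      simp [hq]
    obtain ⟨g, d, hg, hg0, hd, hgd⟩ := exists_family_perturbation hX hXx hδ hw
    have hs : ∀ t : ℝ, SmoothNear (fun z => h.toFun z + t * g z) := fun t =>
      h.smooth.add ((smoothNear_const t).mul hg)
    refine ⟨fun t => ⟨fun z => h.toFun z + t * g z, hs t⟩,
      SmoothGerm.continuous_of_affine h.smooth hg _ fun t z => rfl, ?_, fun t => ?_, ?_⟩
    · simp
    · filter_upwards [hh] with q hq
      simp [hg0, hq]
    · filter_upwards [eventually_linear_ne_zero _ hd] with t ht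
      rw [isRVersal_HbarFamily_iff (hx1.add ((hs t).smul (smoothNear_const w))) ?_ h1 hdet]
      · simp only [add_smul, ← add_assoc]
        rw [hgd]
        exact ht
      · filter_upwards [hh] with q hq
        simp [hg0, hq]

end Families

/-! ### Nondegenerate singular points on germs of surfaces -/

section Surfaces

/-- The 2-jet at the origin of a product with two factors that vanish there. -/
theorem pd_pd_mul_mul {E : Type*} [NormedAddCommGroup E] [NormedSpace ℝ E] {p q a : E → ℝ}
    (hp : SmoothNear p) (hq : SmoothNear q) (ha : SmoothNear a) (hp0 : p 0 = 0) (hq0 : q 0 = 0)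
    (e e' : E) : pd e (fun z => p z * (q z * a z)) 0 = 0 ∧
      pd e' (pd e (fun z => p z * (q z * a z))) 0 =
        (pd e p 0 * pd e' q 0 + pd e' p 0 * pd e q 0) * a 0 := by
  have hqa := hq.mul ha
  have h : ∀ e, ∀ᶠ z in 𝓝 (0 : E), pd e (fun z => p z * (q z * a z)) z =
      pd e p z * (q z * a z) + p z * pd e (fun z => q z * a z) z := by
    intro e
    filter_upwards [hp.eventually_differentiableAt, hqa.eventually_differentiableAt] with z h1 h2
      using pd_mul e h1 h2
  refine ⟨by rw [(h e).self_of_nhds, hp0, hq0]; ring, ?_⟩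
  rw [pd_eq_of_eventuallyEq e' (h e),
    pd_add e' ((hp.dirDeriv e).mul hqa).differentiableAt (hp.mul (hqa.dirDeriv e)).differentiableAt,
    pd_mul e' (hp.dirDeriv e).differentiableAt hqa.differentiableAt,
    pd_mul e' hp.differentiableAt (hqa.dirDeriv e).differentiableAt,
    pd_mul e' hq.differentiableAt ha.differentiableAt,
    pd_mul e hq.differentiableAt ha.differentiableAt, hp0, hq0]
  ring

/-- A displacement of order 4 in a transverse direction, which changes the Hessian of `H̄` at the
origin but not its 1-jet. -/
theorem Hbar_add_quartic {x : Plane → Space} (hx : SmoothNear x) (w : Space) (t : ℝ) :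
    let y : Plane → Space := fun q => x q + t • ((1 / 2 * (q.1 * q.1 * (q.2 * q.2))) • w)
    let T := mink (mcross (pd (1, 0) x 0) (pd (0, 1) x 0)) w
    fderiv ℝ y 0 = fderiv ℝ x 0 ∧ Hbar y 0 = Hbar x 0 ∧ fderiv ℝ (Hbar y) 0 = fderiv ℝ (Hbar x) 0 ∧
      hessDet (Hbar y) =
        (pd (1, 0) (pd (1, 0) (Hbar x)) 0 + 2 * t * T * coeffE x 0) *
        (pd (0, 1) (pd (0, 1) (Hbar x)) 0 + 2 * t * T * coeffG x 0) -
        (pd (0, 1) (pd (1, 0) (Hbar x)) 0 - 4 * t * T * coeffF x 0) ^ 2 := by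
  intro y T
  have hu : SmoothNear (fun q : Plane => q.1) := contDiff_fst.smoothNear
  have hv : SmoothNear (fun q : Plane => q.2) := contDiff_snd.smoothNear
  have k := fun c : ℝ => smoothNear_const (E := Plane) c
  have hw : SmoothNear (fun _ : Plane => w) := smoothNear_const w
  set g : Plane → ℝ := fun q => t * (1 / 2 * (q.1 * q.1 * (q.2 * q.2))) with hg
  have hgs : SmoothNear g := (k t).mul ((k _).mul ((hu.mul hu).mul (hv.mul hv)))
  have hy : y = fun q => x q + g q • w := by
    ext1 q
    simp only [y, hg, smul_smul]
  have p1 : pd (1, 0) g = fun q => t * (q.1 * (q.2 * q.2)) := by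
    ext z
    simp (disch := fun_prop) only [hg, pd_mul, pd_const, pd_coord_one, pd_coord_two]
    ring
  have p2 : pd (0, 1) g = fun q => t * (q.1 * (q.1 * q.2)) := by
    ext z
    simp (disch := fun_prop) only [hg, pd_mul, pd_const, pd_coord_one, pd_coord_two]
    ring
  have p11 : pd (1, 0) (pd (1, 0) g) = fun q => t * (q.2 * q.2) := by
    ext z
    simp (disch := fun_prop) only [p1, pd_mul, pd_const, pd_coord_one, pd_coord_two]
    ring
  have p12 : pd (0, 1) (pd (1, 0) g) = fun q => t * (2 * (q.1 * q.2)) := by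
    ext z
    simp (disch := fun_prop) only [p1, pd_mul, pd_const, pd_coord_one, pd_coord_two]
    ring
  have p22 : pd (0, 1) (pd (0, 1) g) = fun q => t * (q.1 * q.1) := by
    ext z
    simp (disch := fun_prop) only [p2, pd_mul, pd_const, pd_coord_one, pd_coord_two]
    ring
  obtain ⟨R₁, R₂, hR₁, hR₂, hpert⟩ := exists_HbarAlong_add_smul hx hgs w (1, 0) (0, 1)
  have a := hx.dirDeriv (1, 0)
  have b := hx.dirDeriv (0, 1)
  have hT := a.mink_mcross b hw
  have hA := (k t).mul (hT.mul (a.mink a))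
  have hC := (k t).mul (hT.mul (b.mink b))
  have hB := (((k (-4 * t)).mul (hT.mul (a.mink b))).add ((k t).mul (hv.mul hR₁))).add
    ((k t).mul (hu.mul hR₂))
  -- The second derivatives of u²v²/2 are v², 2uv and u², so G multiplies v², F multiplies uv and E
  -- multiplies u². The first-order remainders are uv times a germ vanishing at the origin and do
  -- not affect the 2-jet.
  have hev : Hbar y =ᶠ[𝓝 0] fun q => (Hbar x q +
        q.1 * (q.1 * (t * (mink (mcross (pd (1, 0) x q) (pd (0, 1) x q)) w *
          mink (pd (1, 0) x q) (pd (1, 0) x q))))) +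
        (q.1 * (q.2 * (-4 * t * (mink (mcross (pd (1, 0) x q) (pd (0, 1) x q)) w *
          mink (pd (1, 0) x q) (pd (0, 1) x q)) + t * (q.2 * R₁ q) + t * (q.1 * R₂ q))) +
        q.2 * (q.2 * (t * (mink (mcross (pd (1, 0) x q) (pd (0, 1) x q)) w *
          mink (pd (0, 1) x q) (pd (0, 1) x q))))) := by
    filter_upwards [hpert] with q hq
    rw [hy, Hbar_eq_HbarAlong, Hbar_eq_HbarAlong, hq, p11, p12, p22, p1, p2]
    ring
  have qA := pd_pd_mul_mul hu hu hA rfl rfl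
  have qB := pd_pd_mul_mul hu hv hB rfl rfl
  have qC := pd_pd_mul_mul hv hv hC rfl rfl
  have sA := hu.mul (hu.mul hA)
  have sB := hu.mul (hv.mul hB)
  have sC := hv.mul (hv.mul hC)
  have hH := hx.Hbar
  have d1 : ∀ e : Plane, pd e (Hbar y) =ᶠ[𝓝 0] _ := fun e => by
    refine (pd_eventuallyEq e hev).trans ?_
    filter_upwards [(hH.add sA).eventually_differentiableAt,
      (sB.add sC).eventually_differentiableAt, hH.eventually_differentiableAt,
      sA.eventually_differentiableAt, sB.eventually_differentiableAt,
      sC.eventually_differentiableAt] with q a1 a2 a3 a4 a5 a6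
    rw [pd_add e a1 a2, pd_add e a3 a4, pd_add e a5 a6]
  have e1 : ∀ e : Plane, pd e (Hbar y) 0 = pd e (Hbar x) 0 := by
    intro e
    refine ((d1 e).self_of_nhds).trans ?_
    beta_reduce
    rw [(qA e e).1, (qB e e).1, (qC e e).1]
    ring
  have e2 : ∀ e e' : Plane, pd e' (pd e (Hbar y)) 0 = pd e' (pd e (Hbar x)) 0 +
      (2 * e.1 * e'.1 * (t * T * coeffE x 0) + (e.1 * e'.2 + e'.1 * e.2) * (-4 * t * T * coeffF x 0)
        + 2 * e.2 * e'.2 * (t * T * coeffG x 0)) := by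
    intro e e'
    rw [pd_eq_of_eventuallyEq e' (d1 e),
      pd_add e' ((hH.dirDeriv e).add (sA.dirDeriv e)).differentiableAt
        ((sB.dirDeriv e).add (sC.dirDeriv e)).differentiableAt,
      pd_add e' (hH.dirDeriv e).differentiableAt (sA.dirDeriv e).differentiableAt,
      pd_add e' (sB.dirDeriv e).differentiableAt (sC.dirDeriv e).differentiableAt,
      (qA e e').2, (qB e e').2, (qC e e').2]
    simp only [pd_coord_one, pd_coord_two, Prod.fst_zero, Prod.snd_zero]
    change _ = _ + (2 * e.1 * e'.1 * (t * T * mink (pd (1, 0) x 0) (pd (1, 0) x 0)) +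
      (e.1 * e'.2 + e'.1 * e.2) * (-4 * t * T * mink (pd (1, 0) x 0) (pd (0, 1) x 0)) +
      2 * e.2 * e'.2 * (t * T * mink (pd (0, 1) x 0) (pd (0, 1) x 0)))
    ring
  refine ⟨?_, ?_, ?_, ?_⟩
  · refine ContinuousLinearMap.ext fun e => ?_
    change pd e y 0 = pd e x 0
    rw [hy, pd_add e hx.differentiableAt (hgs.smul hw).differentiableAt,
      pd_smul e hgs.differentiableAt hw.differentiableAt, pd_const, pd_plane g, p1, p2]
    simp [hg]
  · rw [hev.self_of_nhds]
    simp
  · exact ContinuousLinearMap.ext fun e => e1 e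
  · simp only [hessDet, e2]
    ring

theorem LocalParam.contFam_toFun : ContFam (fun x : LocalParam => x.toFun) :=
  SmoothGerm.contFam.comp continuous_induced_dom

/-- The surfaces without a degenerate singular point of the MCNC at their base point form an open
set. -/
theorem isOpen_nondegenerate : IsOpen {g : SurfaceGerm | ∃ x : LocalParam, x.surface = g ∧
    ¬(Hbar x.toFun 0 = 0 ∧ fderiv ℝ (Hbar x.toFun) 0 = 0 ∧ hessDet (Hbar x.toFun) = 0)} := by
  have hH : ContFam (fun x : LocalParam => Hbar x.toFun) :=
    LocalParam.contFam_toFun.HbarAlong (1, 0) (0, 1)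
  have h0 := hH.continuous_apply_zero
  have h1 := fun e : Plane => (hH.2 [e] : Continuous fun x : LocalParam => pd e (Hbar x.toFun) 0)
  have h2 := fun e e' : Plane =>
    (hH.2 [e, e'] : Continuous fun x : LocalParam => pd e' (pd e (Hbar x.toFun)) 0)
  have hdet : Continuous fun x : LocalParam => hessDet (Hbar x.toFun) :=
    ((h2 (1, 0) (1, 0)).mul (h2 (0, 1) (0, 1))).sub ((h2 (1, 0) (0, 1)).pow 2)
  -- The whole conjunction is negated because `hessDet` alone behaves well under reparametrization
  -- only at singular points of the zero set; the conjunction is invariant and closed, so the set is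
  -- saturated and open.
  have hopen : IsOpen {x : LocalParam | ¬(Hbar x.toFun 0 = 0 ∧ fderiv ℝ (Hbar x.toFun) 0 = 0 ∧
      hessDet (Hbar x.toFun) = 0)} := by
    have hc : IsClosed {x : LocalParam | Hbar x.toFun 0 = 0 ∧
        (pd (1, 0) (Hbar x.toFun) 0 = 0 ∧ pd (0, 1) (Hbar x.toFun) 0 = 0) ∧
        hessDet (Hbar x.toFun) = 0} :=
      (isClosed_eq h0 continuous_const).and
        (((isClosed_eq (h1 _) continuous_const).and (isClosed_eq (h1 _) continuous_const)).and
          (isClosed_eq hdet continuous_const))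
    simp only [fderiv_plane_eq_zero_iff]
    exact hc.isOpen_compl
  have hq : IsQuotientMap LocalParam.surface := isQuotientMap_quot_mk
  rw [← hq.isOpen_preimage]
  convert hopen using 1
  ext y
  constructor
  · rintro ⟨x, hxy, hx⟩ ⟨a, b, c⟩
    have hR : REquiv y.toFun x.toFun := Quotient.exact hxy.symm
    obtain ⟨e0, e1, J, -, e2⟩ := hR.Hbar_singular y.smooth a b
    exact hx ⟨e0, e1, by rw [e2, c, mul_zero]⟩
  · exact fun hy => ⟨y, rfl, hy⟩

/-- At a singular point of the MCNC in the Lorentzian region, the generic behaviour is equivalent to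
the nondegeneracy of the singularity. -/
theorem generic_behaviour_iff {g : SurfaceGerm} (hg : g ∈ singularMCNC) :
    (∀ x : LocalParam, x.surface = g → IsA1 (Hbar x.toFun) ∧ GenericallyVersal x) ↔
    ∃ x : LocalParam, x.surface = g ∧
      ¬(Hbar x.toFun 0 = 0 ∧ fderiv ℝ (Hbar x.toFun) 0 = 0 ∧ hessDet (Hbar x.toFun) = 0) := by
  obtain ⟨x₀, hx₀, hδ, h0, h1⟩ := hg
  constructor
  · intro h
    exact ⟨x₀, hx₀, fun hdeg => (h x₀ hx₀).1.hessDet_ne_zero x₀.smooth.Hbar h0 h1 hdeg.2.2⟩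
  · rintro ⟨z, hz, hzd⟩ x hx
    have hR : REquiv x₀.toFun x.toFun := Quotient.exact (hx₀.trans hx.symm)
    obtain ⟨e0, e1, -⟩ := hR.Hbar_singular x₀.smooth h0 h1
    have hR' : REquiv x.toFun z.toFun := Quotient.exact (hx.trans hz.symm)
    obtain ⟨f0, f1, J, -, f2⟩ := hR'.Hbar_singular x.smooth e0 e1
    have hdet : hessDet (Hbar x.toFun) ≠ 0 := fun hx0 => hzd ⟨f0, f1, by rw [f2, hx0, mul_zero]⟩
    exact ⟨isA1_of_hessDet_ne_zero x.smooth.Hbar e0 e1 hdet,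
      genericallyVersal_of_hessDet_ne_zero x (hR.delta_pos x₀.smooth x.smooth h0 h1 hδ) e1 hdet⟩

end Surfaces

end Minkowski

/-- For a generic germ `(M, p)`, where `p` is a singular point of the MCNC in the Lorentzian region,
the MCNC has an `A₁`-singularity at `p`, and in a generic 1-parameter family of surfaces deforming
`(M, p)` this singularity is `R`-versally deformed. -/
theorem mainTheorem7 :
    Minkowski.GenericIn Minkowski.singularMCNC (fun g : Minkowski.SurfaceGerm =>
      ∀ x : Minkowski.LocalParam, x.surface = g →
        Minkowski.IsA1 (Minkowski.Hbar x.toFun) ∧ Minkowski.GenericallyVersal x) := by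
  open Minkowski in
  constructor
  -- Openness: within the singular germs, the generic behaviour is membership in the open set of
  -- nondegenerate germs.
  · convert isOpen_nondegenerate.preimage (continuous_subtype_val (p := (· ∈ singularMCNC))) using 1
    ext g
    exact generic_behaviour_iff g.2
  · refine dense_of_paths (S := singularMCNC) (P := fun g => ∀ x : LocalParam, x.surface = g →
      IsA1 (Hbar x.toFun) ∧ GenericallyVersal x) fun g hg => ?_
    obtain ⟨x, hx, hδ, h0, h1⟩ := hg
    obtain ⟨w, hw⟩ := x.exists_notMem_range
    have hT := x.mink_mcross_ne_zero hw
    have hq : SmoothNear (fun q : Plane => (1 / 2 * (q.1 * q.1 * (q.2 * q.2))) • w) := by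
      apply ContDiff.smoothNear
      fun_prop
    have key := fun t => Hbar_add_quartic x.smooth w t
    -- The quartic path has constant 3-jet at the origin, so it stays among immersions with the same
    -- δ, the same value and the same differential of H̄.
    let c : ℝ → LocalParam := fun t =>
      { toFun := fun q => x.toFun q + t • ((1 / 2 * (q.1 * q.1 * (q.2 * q.2))) • w)
        smooth := x.smooth.add ((smoothNear_const t).smul hq)
        immersion := by
          rw [(key t).1]
          exact x.immersion }
    have hc : Continuous c :=
      continuous_induced_rng.2 (SmoothGerm.continuous_of_affine x.smooth hq _ fun _ _ => rfl)
    have hc0 : c 0 = x := by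
      obtain ⟨⟨f, hf⟩, hi⟩ := x
      simp [c]
    have hS : ∀ t, (c t).surface ∈ singularMCNC := by
      intro t
      refine ⟨c t, rfl, ?_, (key t).2.1.trans h0, (key t).2.2.1.trans h1⟩
      have : delta (c t).toFun 0 = delta x.toFun 0 := by
        have := (key t).1
        simp only [delta, coeffE, coeffF, coeffG, du, dv]
        simp only [c, this]
      rw [this]
      exact hδ
    refine ⟨fun t => (c t).surface, continuous_quot_mk.comp hc, (congrArg LocalParam.surface hc0).trans hx, hS, ?_⟩
    set T := mink (mcross (pd (1, 0) x.toFun 0) (pd (0, 1) x.toFun 0)) w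
    set h11 := pd (1, 0) (pd (1, 0) (Hbar x.toFun)) 0
    set h22 := pd (0, 1) (pd (0, 1) (Hbar x.toFun)) 0
    set h12 := pd (0, 1) (pd (1, 0) (Hbar x.toFun)) 0
    set E := coeffE x.toFun 0
    set F := coeffF x.toFun 0
    set G := coeffG x.toFun 0
    have hδ' : 0 < F ^ 2 - E * G := hδ
    -- The coefficient of t² in the Hessian determinant. In the Lorentzian region EG < F², so EG -
    -- 4F² < -3F² ≤ 0.
    have hlead : 4 * T ^ 2 * (E * G - 4 * F ^ 2) ≠ 0 := by
      refine mul_ne_zero (mul_ne_zero four_ne_zero (pow_ne_zero 2 hT)) ?_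
      nlinarith [sq_nonneg F]
    filter_upwards [eventually_quadratic_ne_zero (h11 * h22 - h12 ^ 2)
      (2 * T * (h11 * G + h22 * E + 4 * h12 * F)) hlead] with t ht
    refine (generic_behaviour_iff (hS t)).2 ⟨c t, rfl, fun hdeg => ht ?_⟩
    have h := (key t).2.2.2.symm.trans hdeg.2.2
    linear_combination h
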